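/- **Model.** Let $q\ge 0$ be an integer and $r$ a real number with $0\le r<1$. Finitely many threads, numbered by integers, execute the following lock-free loop without hardware conflicts. After an initialization of arbitrary length, a thread starts its first retry. A retry lasts $1$ unit of time; its Read takes place at its beginning and its CAS at its end. A retry is successful if and only if no other thread performs a successful CAS between the Read and the CAS of this retry; events that occur at the same instant in different threads are ordered by the thread numbers. After an unsuccessful retry the thread starts a new retry immediately; after a successful one it first executes its parallel section, which lasts $q+r$ units of time, and then starts a new retry. At each time, the state of a thread is its phase (initialization, successful retry, unsuccessful retry, parallel section), together with the time elapsed in the current retry or parallel section. For an integer $C\ge 0$, an execution with $P$ threads is, from some time $\tau$ on, a $(C,P)$-cyclic execution if, from $\tau$ on, (i) it is periodic, i.e. at every time every thread is in the same state as one period later, (ii) the shortest period contains exactly one successful retry of each thread, (iii) the shortest period is $1+q+r+C$. **Theorem.** Assume $r\neq 0$, and let $P\ge 2$ and $f\ge 0$ be integers. Consider an execution with $P-1$ threads that is, from time $\tau$ on, an $(f,P-1)$-cyclic execution. Add a new thread, with any number (the old threads keep their initialization times and relative order), whose first retry starts at any time $a\ge\tau$. Then, in the resulting execution with $P$ threads,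 there is a time from which on the $P$ threads form either an $(f,P)$-cyclic execution or an $(f+1,P)$-cyclic execution. -/

import Mathlib

namespace LockFree

/-- Strict order on the events: the event of thread `i` at time `s` comes before the event of
thread `j` at time `t`. Equal times are ordered by the thread numbers. -/
def Before {P : ℕ} (s : ℝ) (i : Fin P) (t : ℝ) (j : Fin P) : Prop :=
  s < t ∨ (s = t ∧ i < j)

/-- An execution, without hardware conflicts, of the retry-loop algorithm by `P` threads, numbered
by `Fin P`. A retry lasts one unit of time, its Read happens at its beginning and its CAS at its
end. The parallel section has size `q + r`. -/
structure Execution (q : ℕ) (r : ℝ) (P : ℕ) where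
  /-- `start i k` is the starting time of the `k`-th retry, counted from the beginning of the
  execution, of thread `i`. Before `start i 0` the thread is in its initialization. -/
  start : Fin P → ℕ → ℝ
  /-- `success i k`: the CAS of the `k`-th retry of thread `i` succeeds. -/
  success : Fin P → ℕ → Prop
  /-- After a successful retry, the thread executes its parallel section and enters a new retry. -/
  start_succ_of_success : ∀ i k, success i k → start i (k + 1) = start i k + 1 + (q + r)
  /-- After an unsuccessful retry, the thread retries immediately. -/
  start_succ_of_failure : ∀ i k, ¬ success i k → start i (k + 1) = start i k + 1
  /-- A retry succeeds exactly when no other thread performs a successful CAS between the Read and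
  the CAS of this retry. -/
  success_iff : ∀ i k, success i k ↔
    ¬ ∃ j l, j ≠ i ∧ success j l ∧
      Before (start i k) i (start j l + 1) j ∧ Before (start j l + 1) j (start i k + 1) i

/-- The state of a thread at a given time, where `x` is the time elapsed in the current phase. -/
inductive ThreadState where
  | initialization : ThreadState
  | successfulRetry (x : ℝ) : ThreadState
  | unsuccessfulRetry (x : ℝ) : ThreadState
  | parallelSection (x : ℝ) : ThreadState

namespace Execution

variable {q : ℕ} {r : ℝ} {P : ℕ}

/-- Thread `i` is in the given state at time `t`. -/
def InState (E : Execution q r P) (i : Fin P) (t : ℝ) : ThreadState → Prop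
  | .initialization => t < E.start i 0
  | .successfulRetry x => ∃ k, E.success i k ∧ t = E.start i k + x ∧ 0 ≤ x ∧ x < 1
  | .unsuccessfulRetry x => ∃ k, ¬ E.success i k ∧ t = E.start i k + x ∧ 0 ≤ x ∧ x < 1
  | .parallelSection x => ∃ k, E.success i k ∧ t = E.start i k + 1 + x ∧ 0 ≤ x ∧ x < q + r

/-- From time `τ` on, every thread is in the same state as `T` units of time later. -/
def PeriodicFrom (E : Execution q r P) (τ T : ℝ) : Prop :=
  ∀ t, τ ≤ t → ∀ i s, E.InState i (t + T) s ↔ E.InState i t s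

/-- From time `τ` on, the execution is a `(C, P)`-cyclic execution: it is periodic, the shortest
period is `1 + q + r + C`, and every thread begins exactly one successful retry within a
period. -/
def IsCyclicFrom (E : Execution q r P) (C : ℕ) (τ : ℝ) : Prop :=
  IsLeast {T : ℝ | 0 < T ∧ E.PeriodicFrom τ T} (1 + q + r + C) ∧
    ∀ i s, τ ≤ s → ∃! k, E.success i k ∧ s ≤ E.start i k ∧ E.start i k < s + (1 + q + r + C)

/-- `E'` is the execution `E` to which a new thread, numbered `ν`, is added; the first retry of the
new thread starts at time `a`. The old threads, renumbered in the same order, begin as in `E`;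
since the rules are deterministic, they behave as in `E` as long as the new thread has no
success. -/
def AddsThread {n : ℕ} (E : Execution q r n) (E' : Execution q r (n + 1)) (ν : Fin (n + 1))
    (a : ℝ) : Prop :=
  E'.start ν 0 = a ∧ ∀ i : Fin n, E'.start (ν.succAbove i) 0 = E.start i 0

end Execution

/-! Executions exist: the two auxiliary definitions below serve only to prove this. -/

/-- The starting times that result from the initialization times `t` and a pattern of successes. -/
noncomputable def startOf {P : ℕ} (c : ℝ) (t : Fin P → ℝ) (S : Fin P → ℕ → Prop) (i : Fin P) : ℕ → ℝ
  | 0 => t i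
  | k + 1 => open Classical in startOf c t S i k + 1 + (if S i k then c else 0)

/-- The successes that result from the starting times of the pattern `S`. -/
def succStep {P : ℕ} (c : ℝ) (t : Fin P → ℝ) (S : Fin P → ℕ → Prop) (i : Fin P) (k : ℕ) : Prop :=
  ¬ ∃ j l, j ≠ i ∧ S j l ∧
      Before (startOf c t S i k) i (startOf c t S j l + 1) j ∧
      Before (startOf c t S j l + 1) j (startOf c t S i k + 1) i

lemma startOf_congr {P : ℕ} (c : ℝ) (t : Fin P → ℝ) (S S' : Fin P → ℕ → Prop) (i : Fin P) (k : ℕ)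
    (h : ∀ l < k, (S i l ↔ S' i l)) : startOf c t S i k = startOf c t S' i k := by
  induction k with
  | zero => rfl
  | succ k ih =>
    have h1 := ih (fun l hl => h l (by omega))
    have h2 := h k (by omega)
    by_cases hh : S' i k <;> simp [startOf, h1, h2, hh]

lemma startOf_ge {P : ℕ} (c : ℝ) (hc : 0 ≤ c) (t : Fin P → ℝ) (S : Fin P → ℕ → Prop) (i : Fin P)
    (k l : ℕ) : startOf c t S i k + l ≤ startOf c t S i (k + l) := by
  induction l with
  | zero => simp
  | succ l ih =>
    rw [← add_assoc]
    simp only [startOf]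
    push_cast
    split_ifs <;> linarith

/-- If the successes of `S`, `S'` agree for all events that matter, so do the values of `succStep`. -/
lemma succStep_congr {P : ℕ} (c : ℝ) (t : Fin P → ℝ) (S S' : Fin P → ℕ → Prop) (i : Fin P) (k : ℕ)
    (hs : startOf c t S i k = startOf c t S' i k)
    (h : ∀ j ≠ i, ∀ l, ((S j l ↔ S' j l) ∧ startOf c t S j l = startOf c t S' j l) ∨
      (¬ Before (startOf c t S j l + 1) j (startOf c t S i k + 1) i ∧
       ¬ Before (startOf c t S' j l + 1) j (startOf c t S' i k + 1) i)) :
    succStep c t S i k ↔ succStep c t S' i k := by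
  unfold succStep
  rw [not_iff_not]
  refine exists_congr fun j => exists_congr fun l => and_congr_right fun hj => ?_
  rcases h j hj l with ⟨h1, h2⟩ | ⟨h1, h2⟩
  · rw [h1, h2, hs]
  · tauto

lemma before_iff {P : ℕ} (s : ℝ) (i : Fin P) (t : ℝ) (j : Fin P) :
    Before s i t j ↔ toLex (s, i) < toLex (t, j) := by
  rw [Prod.Lex.toLex_lt_toLex]; rfl

/-- Executions exist for all initialization times, and all numbers of threads. -/
theorem exists_execution {q : ℕ} {r : ℝ} (hr : 0 ≤ r) {P : ℕ} (t : Fin P → ℝ) :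
    ∃ E : Execution q r P, ∀ i, E.start i 0 = t i := by
  classical
  set c : ℝ := q + r with hcdef
  have hc : 0 ≤ c := by positivity
  let S : ℕ → Fin P → ℕ → Prop := fun m => (succStep c t)^[m] (fun _ _ => False)
  have hS : ∀ m i k, S (m+1) i k ↔ succStep c t (S m) i k := by
    intro m i k; simp only [S, Function.iterate_succ_apply']
  -- stability
  let St : Fin P → ℕ → Prop := fun i k => (∀ᶠ m in Filter.atTop, S m i k) ∨ (∀ᶠ m in Filter.atTop, ¬ S m i k)
  let SI : Fin P → ℕ → Prop := fun i k => ∀ᶠ m in Filter.atTop, S m i k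
  have hag : ∀ i k, St i k → ∀ᶠ m in Filter.atTop, (S m i k ↔ SI i k) := by
    intro i k h
    by_cases h1 : SI i k
    · filter_upwards [h1] with m hm; tauto
    · rcases h with h | h
      · exact absurd h h1
      · filter_upwards [h] with m hm; tauto
  have hagst : ∀ i k, (∀ l < k, St i l) →
      ∀ᶠ m in Filter.atTop, startOf c t (S m) i k = startOf c t SI i k := by
    intro i k h
    have : ∀ᶠ m in Filter.atTop, ∀ l ∈ Finset.range k, (S m i l ↔ SI i l) := by
      rw [Filter.eventually_all_finset]
      intro l hl
      exact hag i l (h l (by simpa using hl))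
    filter_upwards [this] with m hm
    exact startOf_congr _ _ _ _ _ _ (fun l hl => hm l (by simpa using hl))
  -- main step
  have key : ∀ i k, (∀ l < k, St i l) →
      (∀ j, j ≠ i → (∀ l, St j l) ∨ ∃ k', (∀ l < k', St j l) ∧
        ¬ Before (startOf c t SI j k') j (startOf c t SI i k) i) →
      ∀ᶠ m in Filter.atTop, (S (m+1) i k ↔ succStep c t SI i k) := by
    intro i k hk hj
    have hfin : ∀ j ∈ (Finset.univ : Finset (Fin P)), ∀ᶠ m in Filter.atTop, j ≠ i → ∀ l,
        ((S m j l ↔ SI j l) ∧ startOf c t (S m) j l = startOf c t SI j l) ∨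
        (¬ Before (startOf c t (S m) j l + 1) j (startOf c t SI i k + 1) i ∧
        ¬ Before (startOf c t SI j l + 1) j (startOf c t SI i k + 1) i) := by
      intro j _
      by_cases hji : j = i
      · simp [hji]
      -- a cut-off
      have : ∃ K, (∀ l < K, St j l) ∧ ¬ Before (startOf c t SI j K) j (startOf c t SI i k) i := by
        rcases hj j hji with h | h
        · obtain ⟨K, hK⟩ := exists_nat_gt (startOf c t SI i k - t j)
          refine ⟨K, fun l _ => h l, ?_⟩
          have := startOf_ge c hc t SI j 0 K
          simp only [zero_add, startOf] at this
          unfold Before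
          push Not
          refine ⟨by linarith, fun h => by linarith⟩
        · exact h
      obtain ⟨K, hK, hKb⟩ := this
      have e1 : ∀ᶠ m in Filter.atTop, ∀ l ∈ Finset.range K, (S m j l ↔ SI j l) := by
        rw [Filter.eventually_all_finset]
        intro l hl
        exact hag j l (hK l (by simpa using hl))
      filter_upwards [e1, hagst j K hK] with m hm1 hm2 _ l
      by_cases hl : l < K
      · left
        exact ⟨hm1 l (by simpa using hl),
          startOf_congr _ _ _ _ _ _ (fun l' hl' => hm1 l' (by simp; omega))⟩
      · right
        have aux : ∀ x : ℝ, startOf c t SI j K ≤ x → ¬ Before (x + 1) j (startOf c t SI i k + 1) i := by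
          intro x hx hb
          apply hKb
          rcases hb with hb | ⟨hb, hb'⟩
          · left; linarith
          · rcases hx.lt_or_eq with hx | hx
            · left; linarith
            · right; exact ⟨by linarith, hb'⟩
        obtain ⟨d, rfl⟩ := Nat.exists_eq_add_of_le (not_lt.mp hl)
        have hd : (0:ℝ) ≤ d := by positivity
        constructor
        · apply aux
          have := startOf_ge c hc t (S m) j K d
          linarith
        · apply aux
          have := startOf_ge c hc t SI j K d
          linarith
    have hfin' := (Filter.eventually_all_finset _).mpr hfin
    filter_upwards [hfin', hagst i k hk] with m hm1 hm2
    rw [hS]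
    apply succStep_congr _ _ _ _ _ _ hm2
    intro j hj l
    rw [hm2]
    exact hm1 j (Finset.mem_univ _) hj l
  have conv : ∀ i k, (∀ᶠ m in Filter.atTop, (S (m+1) i k ↔ succStep c t SI i k)) →
      ∀ᶠ m in Filter.atTop, (S m i k ↔ succStep c t SI i k) := by
    intro i k h
    rw [Filter.eventually_atTop] at h ⊢
    obtain ⟨N, hN⟩ := h
    refine ⟨N + 1, fun m hm => ?_⟩
    obtain ⟨d, rfl⟩ := Nat.exists_eq_add_of_le hm
    have := hN (N + d) (by omega)
    rwa [show N + d + 1 = N + 1 + d by omega] at this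
  have allSt : ∀ i k, St i k := by
    by_contra hcon
    push Not at hcon
    have hU : (Finset.univ.filter (fun i => ∃ k, ¬ St i k)).Nonempty := by
      obtain ⟨i, k, h⟩ := hcon
      exact ⟨i, by simp; exact ⟨k, h⟩⟩
    let kk : Fin P → ℕ := fun i => if h : ∃ k, ¬ St i k then Nat.find h else 0
    have hkk : ∀ i l, l < kk i → St i l := by
      intro i l hl
      by_cases h : ∃ k, ¬ St i k
      · simp only [kk, dif_pos h] at hl
        have := Nat.find_min h hl
        tauto
      · push Not at h; exact h l
    have hkk2 : ∀ i, (∃ k, ¬ St i k) → ¬ St i (kk i) := by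
      intro i h
      simp only [kk, dif_pos h]
      exact Nat.find_spec h
    obtain ⟨i, hi, hmin⟩ := Finset.exists_min_image _
      (fun i => toLex (startOf c t SI i (kk i), i)) hU
    simp only [Finset.mem_filter, Finset.mem_univ, true_and] at hi hmin
    apply hkk2 i hi
    have := conv i _ (key i (kk i) (hkk i) (by
      intro j hj
      by_cases h : ∃ k, ¬ St j k
      · right
        refine ⟨kk j, hkk j, ?_⟩
        rw [before_iff]
        exact not_lt.mpr (hmin j h)
      · left; push Not at h; exact h))
    by_cases hP : succStep c t SI i (kk i)
    · left; filter_upwards [this] with m hm; tauto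
    · right; filter_upwards [this] with m hm; tauto
  have hfix : ∀ i k, SI i k ↔ succStep c t SI i k := by
    intro i k
    have h1 := conv i k (key i k (fun l _ => allSt i l) (fun j _ => Or.inl (allSt j)))
    obtain ⟨m, hm1, hm2⟩ := (h1.and (hag i k (allSt i k))).exists
    exact hm2.symm.trans hm1
  refine ⟨⟨startOf c t SI, SI, ?_, ?_, hfix⟩, fun i => rfl⟩
  · intro i k h; simp [startOf, h, hcdef]
  · intro i k h; simp [startOf, h]

end LockFree

set_option linter.unusedSectionVars false

/-! List all successes after the insertion in order, and measure time with one unit removed per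
success: the `l`-th success, starting at real time `s`, gets the virtual time `σ l = s - l`. If a
thread succeeds at index `k`, its later retries can only yield a success at an index `l` with `σ l =
σ k + r + e`, where `e` is an integer with `q + 1 + k ≤ e + l`. The next success is always the
earliest available retry, so the sequence is greedy.

Before the insertion, one round of the `n` old threads advances virtual time by `T - n = r + d`,
where `T = 1 + q + r + f` and `N = n + 1`. With `N` successes per round, a virtual step `r + d`
costs real time `T + 1` (that is, `f + 1` failures), and a step `r + d - 1` costs `T` (that is, `f`
failures). So it must be shown that all steps are eventually equal, and equal to one of these two.

No step exceeds `r + d`, since by then every thread has had its turn and the candidate is available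
(`GreedySeq.exists_next`). No step is below `r + d - 1`: the `f` failures in the old execution mean
that each success has `f` predecessors within virtual distance `1`, and this crowding persists
(`GreedySeq.nx_ge_and_window`). Once a step `r + d - 1` (a jump) occurs, all later steps are jumps
(`GreedySeq.jump_of_jump`). Hence either a jump occurs and `f` failures remain, or none ever occurs
and there are `f + 1`.

Simultaneous events are separated by adding to each time an infinitesimal multiple of the thread
number, so the argument runs in the hyperreals (`Execution.toRun`). The first success of the new
thread exists by counting (`exists_success_new`) and, preceded by three rounds of periodic history,
gives a greedy sequence (`exists_insertion`, `Insertion.greedySeq`). Finally a constant number of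
failures is turned back into cyclicity (`isCyclicFrom_of_regular`). -/

namespace LockFree

/-! ### Greedy sequences in virtual time -/

/-- The successive successful retries of an execution, in order. The `l`-th one is performed by
the thread `th l` and starts at time `σ l + l`. -/
structure GreedySeq {ι K : Type*} [Fintype ι] [Field K] [LinearOrder K] [IsStrictOrderedRing K]
    (r : K) (q f d N : ℕ) (th : ℕ → ι) (σ : ℕ → K) : Prop where
  card_eq : Fintype.card ι = N
  sum_eq : d + N = q + f + 2
  f_lt : f < N
  r_pos : 0 < r
  r_lt : r < 1
  -- Not automatic, because `K` will be the non-archimedean field of hyperreals.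
  arch : ∃ t : ℕ, r + d ≤ t * r
  mono : StrictMono σ
  th_inj : ∀ k l, k < N → l < N → th k = th l → k = l
  th_add : ∀ k < 2 * N, th (k + N) = th k
  σ_add : ∀ k < 2 * N, σ (k + N) = σ k + (r + d)
  -- Crowding of the initial history: this is how the `f` failures of the old threads enter.
  window : ∀ k, N ≤ k → k < 3 * N → ∃ S : Finset ℕ, f ≤ S.card ∧ ∀ m ∈ S, m < k ∧ σ k ≤ σ m + 1
  -- The expression in `u` is the virtual time, at index `l`, of the retry after `u` failures that
  -- follow success `k`. No available candidate is overtaken, and ties are impossible between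
  -- different threads.
  greedy : ∀ l, 3 * N ≤ l → ∀ k < l, (∀ m, k < m → m < l → th m ≠ th k) → ∀ u : ℕ,
    σ (l - 1) ≤ σ k + r + (k + 1 + q + u) - l →
      σ l ≤ σ k + r + (k + 1 + q + u) - l ∧ (σ l = σ k + r + (k + 1 + q + u) - l → th l = th k)
  pick : ∀ l, 3 * N ≤ l → ∀ k < l, th l = th k → (∀ m, k < m → m < l → th m ≠ th k) →
    ∃ u : ℕ, σ l = σ k + r + (k + 1 + q + u) - l

/-- `l` is the first index after `k` that belongs to the same thread. -/
def IsNext {ι : Type*} (th : ℕ → ι) (k l : ℕ) : Prop :=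
  k < l ∧ th l = th k ∧ ∀ m, k < m → m < l → th m ≠ th k

lemma exists_isNext_le {ι : Type*} {th : ℕ → ι} {k l : ℕ} (hkl : k < l)
    (he : th l = th k) : ∃ m, IsNext th k m ∧ m ≤ l := by
  classical
  have hex : ∃ m, k < m ∧ th m = th k := ⟨l, hkl, he⟩
  refine ⟨Nat.find hex, ⟨(Nat.find_spec hex).1, (Nat.find_spec hex).2, fun m hm hml hc =>
    Nat.find_min hex hml ⟨hm, hc⟩⟩, Nat.find_min' hex ⟨hkl, he⟩⟩

namespace GreedySeq

variable {ι K : Type*} [Fintype ι] [Field K] [LinearOrder K] [IsStrictOrderedRing K]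
  {r : K} {q f d N : ℕ} {th : ℕ → ι} {σ : ℕ → K}

lemma exists_th_eq (h : GreedySeq r q f d N th σ) (j : ι) : ∃ k < N, th k = j := by
  have hinj : Function.Injective (fun k : Fin N => th k) := fun a b hab =>
    Fin.ext (h.th_inj a b a.2 b.2 hab)
  have hb := (Fintype.bijective_iff_injective_and_card _).2 ⟨hinj, by simp [h.card_eq]⟩
  obtain ⟨k, hk⟩ := hb.2 j
  exact ⟨k, k.2, hk⟩

lemma exists_last (h : GreedySeq r q f d N th σ) {l : ℕ} (hl : N ≤ l) (j : ι) :
    ∃ k < l, th k = j ∧ ∀ m, k < m → m < l → th m ≠ j := by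
  classical
  obtain ⟨k0, hk0, hj⟩ := h.exists_th_eq j
  have hne : ((Finset.range l).filter (fun k => th k = j)).Nonempty := ⟨k0, by simp [hj]; omega⟩
  have hmem := Finset.max'_mem _ hne
  set k := Finset.max' _ hne with hk
  simp only [Finset.mem_filter, Finset.mem_range] at hmem
  refine ⟨k, hmem.1, hmem.2, fun m hm hml hmj => ?_⟩
  have := Finset.le_max' ((Finset.range l).filter (fun k => th k = j)) m (by simp [hmj, hml])
  omega

lemma add_le_of_th_eq (h : GreedySeq r q f d N th σ) {k l : ℕ} (hkl : k < l) (hl : l < 3 * N)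
    (he : th l = th k) : k + N ≤ l := by
  have hN : 0 < N := by omega
  have hper : ∀ m, m < 3 * N → th m = th (m % N) := by
    intro m hm
    have hdiv : m / N < 3 := Nat.div_lt_of_lt_mul (by omega)
    have hmod := Nat.mod_add_div m N
    have hlt := Nat.mod_lt m hN
    have h1 := h.th_add (m % N) (by omega)
    have h2 := h.th_add (m % N + N) (by omega)
    obtain h0 | h0 | h0 : m / N = 0 ∨ m / N = 1 ∨ m / N = 2 := by
      generalize m / N = x at hdiv
      omega
    · rw [h0] at hmod
      have : m % N = m := by omega
      rw [this]
    · rw [h0] at hmod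
      have : m % N + N = m := by omega
      rw [this] at h1; exact h1
    · rw [h0] at hmod
      have : m % N + N + N = m := by omega
      rw [this, h1] at h2; exact h2
  rw [hper l hl, hper k (by omega)] at he
  have := h.th_inj _ _ (Nat.mod_lt _ hN) (Nat.mod_lt _ hN) he
  have h3 : (l - k) % N = 0 := Nat.sub_mod_eq_zero_of_mod_eq this
  by_contra hc
  rw [Nat.mod_eq_of_lt (by omega)] at h3
  omega

lemma isNext_init (h : GreedySeq r q f d N th σ) {k : ℕ} (hk : k < 2 * N) :
    IsNext th k (k + N) :=
  ⟨by have := h.f_lt; omega, h.th_add k hk, fun m hkm hml he => by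
    have := h.add_le_of_th_eq hkm (by omega) he; omega⟩

/-- Every successful retry of a thread is at a distance `r`, up to an integer, from the preceding
one. -/
lemma step_ge (h : GreedySeq r q f d N th σ) {k l : ℕ} (hkl : IsNext th k l) :
    ∃ e : ℕ, σ l = σ k + r + e ∧ (3 * N ≤ l → q + 1 + k ≤ e + l) := by
  by_cases hl : 3 * N ≤ l
  · obtain ⟨u, hu⟩ := h.pick l hl k hkl.1 hkl.2.1 hkl.2.2
    have h1 := h.mono hkl.1
    have h2 : l < k + 1 + q + u + 1 := by
      have : (l : K) < k + 1 + q + u + 1 := by linarith [h.r_lt]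
      exact_mod_cast this
    refine ⟨k + 1 + q + u - l, ?_, fun _ => by omega⟩
    rw [Nat.cast_sub (by omega), hu]; push_cast; ring
  · have hk2 : k < 2 * N := by
      have := h.add_le_of_th_eq hkl.1 (not_le.1 hl) hkl.2.1
      omega
    have h2 := h.isNext_init hk2
    have : l = k + N := by
      rcases lt_trichotomy l (k + N) with h3 | h3 | h3
      · exact absurd hkl.2.1 (h2.2.2 l hkl.1 h3)
      · exact h3
      · exact absurd h2.2.1 (hkl.2.2 _ h2.1 h3)
    subst this
    exact ⟨d, by rw [h.σ_add k hk2]; ring, fun h' => absurd h' hl⟩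

/-- Pigeonhole: among `N + 1` consecutive successes two belong to one thread, and each step of a
thread is at least `r`. -/
lemma add_r_le (h : GreedySeq r q f d N th σ) (l : ℕ) : σ l + r ≤ σ (l + N) := by
  obtain ⟨a, b, hab, he⟩ := Fintype.exists_ne_map_eq_of_card_lt
    (fun a : Fin (N + 1) => th (l + a)) (by simp [h.card_eq])
  wlog hlt : a < b generalizing a b
  · exact this b a hab.symm he.symm (lt_of_le_of_ne (not_lt.1 hlt) hab.symm)
  obtain ⟨m, hm, hml⟩ := exists_isNext_le (k := l + a) (l := l + b) (by simpa using hlt) he.symm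
  obtain ⟨e, he, -⟩ := h.step_ge hm
  have h1 := h.mono.monotone (show l ≤ l + a by omega)
  have h2 := h.mono.monotone (show m ≤ l + N by have := b.2; omega)
  have h3 : (0 : K) ≤ e := by positivity
  linarith

lemma exists_ge (h : GreedySeq r q f d N th σ) (k : ℕ) : ∃ l, σ k + (r + d) ≤ σ l := by
  obtain ⟨t, ht⟩ := h.arch
  have : ∀ t : ℕ, σ k + t * r ≤ σ (k + t * N) := by
    intro t
    induction t with
    | zero => simp
    | succ t ih =>
      have := h.add_r_le (k + t * N)
      rw [show k + (t + 1) * N = k + t * N + N by ring]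
      push_cast
      linarith
  exact ⟨k + t * N, by linarith [this t]⟩

/-- Strong induction on `k`, with `l` the first index at which `σ` reaches `σ k + (r + d)`. If the
thread of `k` is absent strictly between, the induction hypothesis places every thread in `[k, l)`.
So `l - k ≥ N`, which makes the candidate `σ k + (r + d)` available, and greediness forces it to be
chosen. -/
lemma exists_next (h : GreedySeq r q f d N th σ) (k : ℕ) :
    ∃ l, IsNext th k l ∧ σ l ≤ σ k + (r + d) := by
  classical
  induction k using Nat.strong_induction_on with
  | _ k ih =>
  by_cases hk : k < 2 * N
  · exact ⟨_, h.isNext_init hk, (h.σ_add k hk).le⟩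
  have hf := h.f_lt
  obtain ⟨l, hl, hmin⟩ : ∃ l, σ k + (r + d) ≤ σ l ∧ ∀ m < l, σ m < σ k + (r + d) :=
    ⟨Nat.find (h.exists_ge k), Nat.find_spec (h.exists_ge k),
      fun m hm => not_le.1 (Nat.find_min (h.exists_ge k) hm)⟩
  have hd0 : (0 : K) ≤ d := by positivity
  have hr := h.r_pos
  have hkl : k < l := by
    by_contra hc
    have := h.mono.monotone (not_lt.1 hc)
    linarith
  by_cases hth : ∃ m, k < m ∧ m < l ∧ th m = th k
  · obtain ⟨m, hm, hml, he⟩ := hth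
    obtain ⟨m', hm', hle⟩ := exists_isNext_le hm he
    exact ⟨m', hm', (hmin m' (by omega)).le⟩
  push Not at hth
  -- every thread has an index in `[k, l)`
  have hcov : ∀ j, ∃ m, k ≤ m ∧ m < l ∧ th m = j := by
    intro j
    by_cases hj : j = th k
    · exact ⟨k, le_rfl, hkl, hj.symm⟩
    obtain ⟨m, hm, hmj, hlast⟩ := h.exists_last (show N ≤ k by omega) j
    obtain ⟨m', hm', hle⟩ := ih m hm
    have h1 := h.mono hm
    refine ⟨m', ?_, ?_, by rw [hm'.2.1, hmj]⟩
    · by_contra hc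
      exact hlast m' hm'.1 (by omega) (by rw [hm'.2.1, hmj])
    · by_contra hc
      have := h.mono.monotone (not_lt.1 hc)
      linarith
  have hcard : N ≤ l - k := by
    choose g hg1 hg2 hg3 using hcov
    have hinj : Function.Injective g := fun a b hab => by rw [← hg3 a, ← hg3 b, hab]
    have := Finset.card_le_card_of_injOn (s := Finset.univ) (t := Finset.Ico k l) g
      (fun a _ => by simp [hg1 a, hg2 a]) hinj.injOn
    simpa [h.card_eq] using this
  have hN3 : 3 * N ≤ l := by omega
  have hsum := h.sum_eq
  obtain ⟨u, hu⟩ : ∃ u : ℕ, k + 1 + q + u = l + d := ⟨l + d - (k + 1 + q), by omega⟩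
  have huK : (k : K) + 1 + q + u = l + d := by exact_mod_cast hu
  have hy : σ k + r + (k + 1 + q + u) - l = σ k + (r + d) := by rw [huK]; ring
  have h3 := h.greedy l hN3 k hkl hth u (by rw [hy]; exact (hmin _ (by omega)).le)
  rw [hy] at h3
  exact ⟨l, ⟨hkl, h3.2 (le_antisymm h3.1 hl), hth⟩, h3.1⟩

/-- The next index of the same thread. -/
noncomputable def nx (h : GreedySeq r q f d N th σ) (k : ℕ) : ℕ := (h.exists_next k).choose

lemma isNext_nx (h : GreedySeq r q f d N th σ) (k : ℕ) : IsNext th k (h.nx k) :=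
  (h.exists_next k).choose_spec.1

lemma σ_nx_le (h : GreedySeq r q f d N th σ) (k : ℕ) : σ (h.nx k) ≤ σ k + (r + d) :=
  (h.exists_next k).choose_spec.2

lemma lt_nx (h : GreedySeq r q f d N th σ) (k : ℕ) : k < h.nx k := (h.isNext_nx k).1

lemma nx_eq (h : GreedySeq r q f d N th σ) {k l : ℕ} (hkl : IsNext th k l) : h.nx k = l := by
  have h2 := h.isNext_nx k
  rcases lt_trichotomy (h.nx k) l with h3 | h3 | h3
  · exact absurd h2.2.1 (hkl.2.2 _ h2.1 h3)
  · exact h3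
  · exact absurd hkl.2.1 (h2.2.2 _ hkl.1 h3)

lemma nx_injective (h : GreedySeq r q f d N th σ) : Function.Injective h.nx := by
  intro a b hab
  have ha := h.isNext_nx a
  have hb := h.isNext_nx b
  rw [hab] at ha
  rcases lt_trichotomy a b with h3 | h3 | h3
  · exact absurd (hb.2.1.symm.trans ha.2.1) (ha.2.2 b h3 hb.1)
  · exact h3
  · exact absurd (ha.2.1.symm.trans hb.2.1) (hb.2.2 a h3 ha.1)

lemma exists_nx_eq (h : GreedySeq r q f d N th σ) {l : ℕ} (hl : N ≤ l) : ∃ k, h.nx k = l := by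
  obtain ⟨k, hk, hj, hlast⟩ := h.exists_last hl (th l)
  exact ⟨k, h.nx_eq ⟨hk, hj.symm, fun m hm hml => by rw [hj]; exact hlast m hm hml⟩⟩

lemma nx_of_lt (h : GreedySeq r q f d N th σ) {k : ℕ} (hk : h.nx k < 3 * N) :
    k < 2 * N ∧ h.nx k = k + N := by
  have hn := h.isNext_nx k
  have h1 := h.add_le_of_th_eq hn.1 hk hn.2.1
  have h2 : k < 2 * N := by omega
  exact ⟨h2, h.nx_eq (h.isNext_init h2)⟩

lemma le_nx (h : GreedySeq r q f d N th σ) (k : ℕ) : N ≤ h.nx k := by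
  by_cases hk : h.nx k < 3 * N
  · have := (h.nx_of_lt hk).2
    omega
  · omega

/-- Each of the `N` threads has a last index before `l`. -/
lemma card_last (h : GreedySeq r q f d N th σ) {l : ℕ} (hl : N ≤ l) :
    ((Finset.range l).filter (fun m => l ≤ h.nx m)).card = N := by
  classical
  refine Eq.trans ?_ h.card_eq
  rw [← Finset.card_univ]
  refine Finset.card_bij (fun m _ => th m) (fun _ _ => Finset.mem_univ _) ?_ ?_
  · intro a ha b hb hab
    simp only [Finset.mem_filter, Finset.mem_range] at ha hb
    rcases lt_trichotomy a b with h3 | h3 | h3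
    · exact absurd hab.symm ((h.isNext_nx a).2.2 b h3 (by omega))
    · exact h3
    · exact absurd hab ((h.isNext_nx b).2.2 a h3 (by omega))
  · intro j _
    obtain ⟨k, hk, hj, hlast⟩ := h.exists_last hl j
    refine ⟨k, ?_, hj⟩
    simp only [Finset.mem_filter, Finset.mem_range]
    refine ⟨hk, ?_⟩
    by_contra hc
    exact hlast _ (h.lt_nx k) (not_le.1 hc) ((h.isNext_nx k).2.1.trans hj)

/-- If no thread repeats within `[k, l)`, these `l - k` indices are all last occurrences; the other
last occurrences lie before `k`. This identity converts the number of overdue threads into the index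
distance `l - k`, which decides whether a candidate is available. -/
lemma card_last_add (h : GreedySeq r q f d N th σ) {k l : ℕ} (hl : N ≤ l) (hkl : k ≤ l)
    (hm : ∀ m, k ≤ m → m < l → l ≤ h.nx m) :
    ((Finset.range k).filter (fun m => l ≤ h.nx m)).card + (l - k) = N := by
  classical
  refine Eq.trans ?_ (h.card_last hl)
  rw [← Nat.card_Ico k l, ← Finset.card_union_of_disjoint]
  · congr 1
    ext m
    simp only [Finset.mem_union, Finset.mem_filter, Finset.mem_range, Finset.mem_Ico]
    constructor
    · rintro (⟨h1, h2⟩ | ⟨h1, h2⟩)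
      · exact ⟨by omega, h2⟩
      · exact ⟨h2, hm m h1 h2⟩
    · rintro ⟨h1, h2⟩
      rcases Nat.lt_or_ge m k with h3 | h3
      · exact Or.inl ⟨h3, h2⟩
      · exact Or.inr ⟨h3, h1⟩
  · rw [Finset.disjoint_left]
    intro m h1 h2
    simp only [Finset.mem_filter, Finset.mem_range, Finset.mem_Ico] at h1 h2
    omega

lemma jump_or_stay (h : GreedySeq r q f d N th σ) {k : ℕ} (hk : σ k + (r + d) - 1 ≤ σ (h.nx k)) :
    σ (h.nx k) = σ k + (r + d) - 1 ∨ σ (h.nx k) = σ k + (r + d) := by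
  obtain ⟨e, he, -⟩ := h.step_ge (h.isNext_nx k)
  have h1 := h.σ_nx_le k
  have h2 : e ≤ d := by
    have : (e : K) ≤ d := by linarith
    exact_mod_cast this
  have h3 : d ≤ e + 1 := by
    have : (d : K) ≤ e + 1 := by linarith
    exact_mod_cast this
  obtain h4 | h4 : d = e + 1 ∨ d = e := by omega
  · left; rw [he, h4]; push_cast; ring
  · right; rw [he, h4]; ring

lemma exists_first (h : GreedySeq r q f d N th σ) {y : K} {l : ℕ} (hl : y ≤ σ l) :
    ∃ m ≤ l, y ≤ σ m ∧ ∀ m' < m, σ m' < y := by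
  classical
  have hex : ∃ l, y ≤ σ l := ⟨l, hl⟩
  have _ := h.r_pos
  exact ⟨Nat.find hex, Nat.find_min' hex hl, Nat.find_spec hex,
    fun m hm => not_le.1 (Nat.find_min hex hm)⟩

/-- Once a retry comes one round earlier than expected, so do all later ones. -/
lemma jump_of_jump (h : GreedySeq r q f d N th σ) {B : ℕ}
    (hP : ∀ k, h.nx k < B → σ k + (r + d) - 1 ≤ σ (h.nx k)) {k₀ : ℕ} (h0 : h.nx k₀ ≤ B)
    (hj : σ (h.nx k₀) = σ k₀ + (r + d) - 1) (k : ℕ) (hk : k₀ ≤ k) (l : ℕ) (hlB : l ≤ B)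
    (hl1 : σ k + (r + d) - 1 ≤ σ l) (hl2 : ∀ m < l, σ m < σ k + (r + d) - 1) :
    h.nx k = l ∧ σ l = σ k + (r + d) - 1 := by
  classical
  have hr := h.r_pos
  obtain ⟨e, he, heq⟩ := h.step_ge (h.isNext_nx k₀)
  have hed : d = e + 1 := by
    have : (d : K) = e + 1 := by linarith
    exact_mod_cast this
  have h3N : 3 * N ≤ h.nx k₀ := by
    by_contra hc
    have h1 := h.nx_of_lt (not_le.1 hc)
    have h2 := h.σ_add k₀ h1.1
    rw [h1.2] at hj
    linarith
  have hNN : N ≤ h.nx k₀ := h.le_nx _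
  have hdK : (d : K) = e + 1 := by rw [hed]; push_cast; rfl
  have he0 : (0 : K) ≤ e := by positivity
  -- Steps are at least `r + d - 1` below `B`, so nothing in `[k₀, nx k₀)` recurs before `nx k₀`.
  have c0 := h.card_last_add (k := k₀) hNN (h.lt_nx _).le (by
    intro m hm hml
    by_contra hc
    have h1 := hP m (by omega)
    have h2 := h.mono (not_le.1 hc)
    have h3 := h.mono.monotone hm
    linarith)
  induction k using Nat.strong_induction_on generalizing l with
  | _ k ih =>
  have hkl : k < l := by
    by_contra hc
    have := h.mono.monotone (not_lt.1 hc)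
    linarith
  have hge : ∀ m, k ≤ m → m < l → l ≤ h.nx m := by
    intro m hm hml
    by_contra hc
    have h1 := hP m (by omega)
    have h2 := hl2 _ (not_le.1 hc)
    have h3 := h.mono.monotone hm
    linarith
  have hll : h.nx k₀ ≤ l := by
    have := h.mono.monotone hk
    rw [← h.mono.le_iff_le]
    linarith
  have c1 := h.card_last_add (k := k) (by omega) hkl.le hge
  -- Every index from `k₀` up to `k` jumps as well, hence has already recurred before `l`. So the
  -- overdue threads at `l` were overdue at `nx k₀`, and the counts give `l - k ≥ nx k₀ - k₀`: since
  -- the early candidate was available for `k₀`, it is available for `k`.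
  have hsub : (Finset.range k).filter (fun m => l ≤ h.nx m) ⊆
      (Finset.range k₀).filter (fun m => h.nx k₀ ≤ h.nx m) := by
    intro m hm
    simp only [Finset.mem_filter, Finset.mem_range] at hm ⊢
    refine ⟨?_, by omega⟩
    by_contra hc
    have hmk := h.mono hm.1
    obtain ⟨l', hl', h1, h2⟩ := h.exists_first (y := σ m + (r + d) - 1) (l := l) (by linarith)
    have h3 := ih m hm.1 (not_lt.1 hc) l' (by omega) h1 h2
    have : l' = l := by omega
    subst this
    linarith [h3.2]
  have hcard := Finset.card_le_card hsub
  have hq := heq h3N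
  obtain ⟨u, hu⟩ : ∃ u : ℕ, k + 1 + q + u = l + e := ⟨l + e - (k + 1 + q), by omega⟩
  have huK : (k : K) + 1 + q + u = l + e := by exact_mod_cast hu
  have hy : σ k + r + (k + 1 + q + u) - l = σ k + (r + d) - 1 := by rw [huK, hdK]; ring
  have hlast := hge k le_rfl hkl
  have hbet : ∀ m, k < m → m < l → th m ≠ th k := fun m hm hml =>
    (h.isNext_nx k).2.2 m hm (by omega)
  have h3 := h.greedy l (by omega) k hkl hbet u (by rw [hy]; exact (hl2 _ (by omega)).le)
  rw [hy] at h3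
  have h4 := le_antisymm h3.1 hl1
  exact ⟨h.nx_eq ⟨hkl, h3.2 h4, hbet⟩, h4⟩

/-- The two claims support each other in one induction: the window at an earlier index excludes too
short a step into `B`, and the bound on earlier steps carries a window forward to `B`. -/
lemma nx_ge_and_window (h : GreedySeq r q f d N th σ) (B : ℕ) (hB : N ≤ B) :
    (∀ k, h.nx k = B → σ k + (r + d) - 1 ≤ σ (h.nx k)) ∧
    ∃ S : Finset ℕ, f ≤ S.card ∧ ∀ m ∈ S, m < B ∧ σ B ≤ σ m + 1 := by
  classical
  induction B using Nat.strong_induction_on with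
  | _ B ih =>
  have hr := h.r_pos
  by_cases hB3 : B < 3 * N
  · refine ⟨fun k hk => ?_, h.window B hB hB3⟩
    have h1 := h.nx_of_lt (k := k) (by omega)
    rw [h1.2, h.σ_add k h1.1]
    linarith
  have hP : ∀ k, h.nx k < B → σ k + (r + d) - 1 ≤ σ (h.nx k) := fun k hk =>
    (ih _ hk (h.le_nx k)).1 k rfl
  obtain ⟨p, hp⟩ := h.exists_nx_eq hB
  have hpB : p < B := by rw [← hp]; exact h.lt_nx p
  have hp2 : 2 * N ≤ p := by
    by_contra hc
    have := h.nx_eq (h.isNext_init (not_le.1 hc))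
    omega
  obtain ⟨S, hS, hSm⟩ := (ih p hpB (by omega)).2
  -- If the step were `r + e` with `e ≤ d - 2`, the `f` indices in the window of `p` could not recur
  -- before `B`. Then `B - p ≤ N - f`, and availability `q + 1 + p ≤ e + B` gives `e ≥ d - 1`.
  have hPB : σ p + (r + d) - 1 ≤ σ B := by
    by_contra hc
    rw [not_le] at hc
    obtain ⟨e, he, heq⟩ := h.step_ge (h.isNext_nx p)
    rw [hp] at he heq
    have hed : e + 2 ≤ d := by
      have : (e : K) + 1 < d := by linarith
      have : e + 1 < d := by exact_mod_cast this
      omega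
    have hedK : (e : K) + 2 ≤ d := by exact_mod_cast hed
    have c := h.card_last_add hB hpB.le (by
      intro m hm hml
      by_contra hc'
      have h1 := hP m (by omega)
      have h2 := h.mono (not_le.1 hc')
      have h3 := h.mono.monotone hm
      linarith)
    have hsub : S ⊆ (Finset.range p).filter (fun m => B ≤ h.nx m) := by
      intro m hm
      obtain ⟨h1, h2⟩ := hSm m hm
      simp only [Finset.mem_filter, Finset.mem_range]
      refine ⟨h1, ?_⟩
      by_contra hc'
      have h3 := hP m (by omega)
      have h4 := h.mono (not_le.1 hc')
      linarith
    have := Finset.card_le_card hsub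
    have := heq (by omega)
    have := h.sum_eq
    omega
  refine ⟨fun k hk => ?_, ?_⟩
  · obtain rfl := h.nx_injective (hk.trans hp.symm)
    rw [hp]; exact hPB
  -- the image of a window under `nx`
  have himg : ∀ S : Finset ℕ, f ≤ S.card → (∀ m ∈ S, h.nx m < B ∧ σ B ≤ σ (h.nx m) + 1) →
      ∃ S : Finset ℕ, f ≤ S.card ∧ ∀ m ∈ S, m < B ∧ σ B ≤ σ m + 1 := by
    intro S hS hSm
    refine ⟨S.image h.nx, by rwa [Finset.card_image_of_injective _ h.nx_injective], ?_⟩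
    intro m hm
    obtain ⟨m', hm', rfl⟩ := Finset.mem_image.1 hm
    exact hSm m' hm'
  rcases h.jump_or_stay (k := p) (by rw [hp]; exact hPB) with hst | hst <;> rw [hp] at hst
  · have hd1 : (1 : K) ≤ d := by
      obtain ⟨e, he, -⟩ := h.step_ge (h.isNext_nx p)
      rw [hp] at he
      have : (d : K) = e + 1 := by linarith
      have : (0 : K) ≤ e := by positivity
      linarith
    -- Here `p` jumps. If jumping had begun by `m₁`, the window of `p` lies in `[m₁, p)` and moves
    -- along with `p`. If not, the window of `m₁` is used: it lies in `[σ p - 2, σ p - 1)`, and its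
    -- full steps `r + d` land it in `[σ B - 1, σ B)`.
    obtain ⟨m₁, hm₁p, h1, h2⟩ := h.exists_first (y := σ p - 1) (l := p) (by linarith)
    -- The reason for three rounds of history: `p` lies in the third round or later, so `m₁` is past
    -- the first round and has a window itself.
    have hNm : N ≤ m₁ := by
      by_contra hc
      have h3 := h.mono.monotone (show m₁ ≤ N - 1 by omega)
      have h4 := h.σ_add (N - 1) (by omega)
      have h5 := h.mono.monotone (show N - 1 + N ≤ p by omega)
      linarith
    by_cases hj : ∃ k₀ ≤ m₁, h.nx k₀ ≤ B ∧ σ (h.nx k₀) = σ k₀ + (r + d) - 1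
    · obtain ⟨k₀, hk₀, hk₀B, hj⟩ := hj
      refine himg S hS fun m hm => ?_
      obtain ⟨h3, h4⟩ := hSm m hm
      have h5 := h.mono h3
      have h6 : m₁ ≤ m := by
        by_contra hc
        have := h2 m (not_le.1 hc)
        linarith
      obtain ⟨l', hl', h7, h8⟩ := h.exists_first (y := σ m + (r + d) - 1) (l := B) (by linarith)
      obtain ⟨h9, h10⟩ := h.jump_of_jump hP hk₀B hj m (by omega) l' hl' h7 h8
      rw [h9]
      refine ⟨?_, by linarith⟩
      rw [← h.mono.lt_iff_lt]
      linarith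
    · push Not at hj
      obtain ⟨S₁, hS₁, hS₁m⟩ := (ih m₁ (by omega) hNm).2
      refine himg S₁ hS₁ fun m hm => ?_
      obtain ⟨h3, h4⟩ := hS₁m m hm
      have h5 := h2 m h3
      have h6 := h.σ_nx_le m
      have h7 : h.nx m < B := by
        rw [← h.mono.lt_iff_lt]
        linarith
      refine ⟨h7, ?_⟩
      rcases h.jump_or_stay (hP m h7) with h8 | h8
      · exact absurd h8 (hj m h3.le h7.le)
      · linarith
  · refine himg S hS fun m hm => ?_
    obtain ⟨h3, h4⟩ := hSm m hm
    have h5 := h.mono h3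
    have h6 := h.σ_nx_le m
    have h7 : h.nx m < B := by
      rw [← h.mono.lt_iff_lt]
      linarith
    refine ⟨h7, ?_⟩
    rcases h.jump_or_stay (hP m h7) with h8 | h8
    -- A jump at `m < p` would force `p` to jump, but here `p` makes a full step.
    · obtain ⟨l', hl', h9, h10⟩ := h.exists_first (y := σ p + (r + d) - 1) (l := B) (by linarith)
      obtain ⟨h11, h12⟩ := h.jump_of_jump hP h7.le h8 p h3.le l' hl' h9 h10
      rw [hp] at h11
      subst h11
      linarith
    · linarith

/-- If `nx` preserves the order relative to `k`, no earlier index is still overdue at `nx k`, so all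
`N` last occurrences lie in `[k, nx k)`. -/
lemma nx_eq_add (h : GreedySeq r q f d N th σ) {k : ℕ} (h1 : ∀ m < k, h.nx m < h.nx k)
    (h2 : ∀ m > k, h.nx k < h.nx m) : h.nx k = k + N := by
  have := h.card_last_add (h.le_nx k) (h.lt_nx k).le (by
    intro m hm _
    rcases hm.lt_or_eq with h3 | rfl
    · exact (h2 m h3).le
    · exact le_rfl)
  rw [Finset.filter_false_of_mem (by
    intro m hm
    have := h1 m (Finset.mem_range.1 hm)
    omega)] at this
  have := h.lt_nx k
  simp only [Finset.card_empty] at *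
  omega

/-- Eventually, every thread succeeds after the same number of failures, `f` or `f + 1`. -/
theorem eventually_const (h : GreedySeq r q f d N th σ) :
    ∃ F, (F = f ∨ F = f + 1) ∧ ∃ k₀, ∀ k ≥ k₀, ∃ l, IsNext th k l ∧
      σ l + l = σ k + k + 1 + (q + r) + F := by
  have hsum : (d : K) + N = q + f + 2 := by exact_mod_cast h.sum_eq
  have hP : ∀ k, σ k + (r + d) - 1 ≤ σ (h.nx k) := fun k =>
    (h.nx_ge_and_window _ (h.le_nx k)).1 k rfl
  by_cases hj : ∃ k₀, σ (h.nx k₀) = σ k₀ + (r + d) - 1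
  · obtain ⟨k₀, hj⟩ := hj
    have hall : ∀ k ≥ k₀, σ (h.nx k) = σ k + (r + d) - 1 := by
      intro k hk
      obtain ⟨l, -, h1, h2⟩ := h.exists_first (hP k)
      obtain ⟨h3, h4⟩ := h.jump_of_jump (B := max l (h.nx k₀)) (fun k _ => hP k)
        (le_max_right _ _) hj k hk l (le_max_left _ _) h1 h2
      rw [h3, h4]
    -- The sum is a crude bound exceeding `nx m` for all the finitely many `m < k₀`, on whose steps
    -- nothing is known.
    refine ⟨f, Or.inl rfl, k₀ + ∑ m ∈ Finset.range k₀, h.nx m, fun k hk => ⟨_, h.isNext_nx k, ?_⟩⟩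
    have hmono : ∀ m ≥ k₀, ∀ m' > m, h.nx m < h.nx m' := by
      intro m hm m' hm'
      rw [← h.mono.lt_iff_lt, hall m hm, hall m' (by omega)]
      have := h.mono hm'
      linarith
    have hk' := h.nx_eq_add (k := k) (by
      intro m hm
      rcases Nat.lt_or_ge m k₀ with h1 | h1
      · have h2 := Finset.single_le_sum (f := h.nx) (fun _ _ => Nat.zero_le _)
          (Finset.mem_range.2 h1)
        have := h.lt_nx k
        omega
      · exact hmono m h1 k hm) (hmono k (by omega))
    rw [hall k (by omega), hk']
    push_cast
    linarith
  · push Not at hj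
    have hall : ∀ k, σ (h.nx k) = σ k + (r + d) := fun k =>
      (h.jump_or_stay (hP k)).resolve_left (hj k)
    refine ⟨f + 1, Or.inr rfl, 0, fun k _ => ⟨_, h.isNext_nx k, ?_⟩⟩
    have hmono : ∀ m, ∀ m' > m, h.nx m < h.nx m' := by
      intro m m' hm'
      rw [← h.mono.lt_iff_lt, hall m, hall m']
      have := h.mono hm'
      linarith
    have hk' := h.nx_eq_add (k := k) (fun m hm => hmono m k hm) (hmono k)
    rw [hall k, hk']
    push_cast
    linarith

lemma exists_th_eq_ge (h : GreedySeq r q f d N th σ) (j : ι) (k₀ : ℕ) : ∃ k ≥ k₀, th k = j := by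
  induction k₀ with
  | zero =>
    obtain ⟨k, -, hk⟩ := h.exists_th_eq j
    exact ⟨k, Nat.zero_le _, hk⟩
  | succ k₀ ih =>
    obtain ⟨k, hk, hj⟩ := ih
    exact ⟨h.nx k, by have := h.lt_nx k; omega, (h.isNext_nx k).2.1.trans hj⟩

end GreedySeq
-- Executions with pairwise distinct event times
/-- An execution whose events have pairwise different times in an ordered field. The time between
the end of a successful retry and the next retry is `c`. -/
structure Run (ι K : Type*) [Field K] [LinearOrder K] (c : K) where
  start : ι → ℕ → K
  success : ι → ℕ → Prop
  start_succ_of_success : ∀ i k, success i k → start i (k + 1) = start i k + 1 + c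
  start_succ_of_failure : ∀ i k, ¬ success i k → start i (k + 1) = start i k + 1
  success_iff : ∀ i k, success i k ↔ ¬ ∃ j l, j ≠ i ∧ success j l ∧
    start i k < start j l + 1 ∧ start j l + 1 < start i k + 1
  start_ne : ∀ i j, i ≠ j → ∀ k l (m : ℕ), start i k ≠ start j l + m
  exists_lt : ∀ i j k l, ∃ m : ℕ, start i k < start j l + m

namespace Run

variable {ι K : Type*} [Field K] [LinearOrder K] [IsStrictOrderedRing K] {c : K}

lemma start_add_le (A : Run ι K c) (hc : 0 < c) (i : ι) (k m : ℕ) :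
    A.start i k + m ≤ A.start i (k + m) := by
  induction m with
  | zero => simp
  | succ m ih =>
    rw [← add_assoc]
    push_cast
    by_cases h : A.success i (k + m)
    · rw [A.start_succ_of_success _ _ h]; linarith
    · rw [A.start_succ_of_failure _ _ h]; linarith

lemma start_strictMono (A : Run ι K c) (hc : 0 < c) (i : ι) : StrictMono (A.start i) :=
  strictMono_nat_of_lt_succ fun k => by
    have := A.start_add_le hc i k 1
    push_cast at this
    linarith

lemma start_add_of_failures (A : Run ι K c) (i : ι) (k m : ℕ)
    (h : ∀ l, k ≤ l → l < k + m → ¬ A.success i l) : A.start i (k + m) = A.start i k + m := by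
  induction m with
  | zero => simp
  | succ m ih =>
    rw [← add_assoc, A.start_succ_of_failure _ _ (h _ (by omega) (by omega)),
      ih fun l h1 h2 => h l h1 (by omega)]
    push_cast; ring

lemma start_ge_of_success (A : Run ι K c) (hc : 0 < c) {i : ι} {k l : ℕ} (hk : A.success i k)
    (hkl : k < l) : A.start i k + 1 + c ≤ A.start i l := by
  rw [← A.start_succ_of_success i k hk]
  exact (A.start_strictMono hc i).monotone hkl

lemma start_ne_add_one (A : Run ι K c) (hc : 0 < c) {i j : ι} {k l : ℕ} (hl : A.success j l) :
    A.start i k ≠ A.start j l + 1 := by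
  by_cases hij : i = j
  · subst hij
    rcases Nat.lt_or_ge l k with h | h
    · have := A.start_ge_of_success hc hl h
      intro h'; linarith
    · have := (A.start_strictMono hc i).monotone h
      intro h'; linarith
  · have := A.start_ne i j hij k l 1
    rwa [Nat.cast_one] at this

/-- If the second retry started before the first one ended, the CAS of the first would fall inside
the second and make it fail. -/
lemma gap (A : Run ι K c) (hc : 0 < c) {i j : ι} {k l : ℕ} (hk : A.success i k)
    (hl : A.success j l) (h : A.start i k < A.start j l) : A.start i k + 1 < A.start j l := by
  by_cases hij : i = j
  · subst hij
    have := A.start_ge_of_success hc hk ((A.start_strictMono hc i).lt_iff_lt.1 h)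
    linarith
  · by_contra hcon
    have h1 := A.start_ne_add_one hc (i := j) (k := l) hk
    have h2 := lt_of_le_of_ne (not_lt.1 hcon) h1
    exact (A.success_iff j l).1 hl ⟨i, k, hij, hk, h2, by linarith⟩

lemma eq_of_start_eq (A : Run ι K c) (hc : 0 < c) {i j : ι} {k l : ℕ}
    (h : A.start i k = A.start j l) : i = j ∧ k = l := by
  by_cases hij : i = j
  · subst hij
    exact ⟨rfl, (A.start_strictMono hc i).injective h⟩
  · exact absurd (by simpa using h) (A.start_ne i j hij k l 0)

/-- The first retry that starts after a successful one is the next successful retry. -/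
lemma exists_next [Fintype ι] (A : Run ι K c) (hc : 0 < c) {i : ι} {k : ℕ} (hk : A.success i k) :
    ∃ p : ι × ℕ, A.success p.1 p.2 ∧ A.start i k + 1 < A.start p.1 p.2 ∧
      ∀ j l, A.start i k + 1 < A.start j l → A.start p.1 p.2 ≤ A.start j l := by
  classical
  have hex : ∀ j, ∃ l, A.start i k + 1 < A.start j l := by
    intro j
    obtain ⟨m, hm⟩ := A.exists_lt i j k 0
    have := A.start_add_le hc j 0 (m + 1)
    push_cast at this
    exact ⟨0 + (m + 1), by linarith⟩
  obtain ⟨j, -, hj⟩ := Finset.exists_min_image Finset.univ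
    (fun j => A.start j (Nat.find (hex j))) ⟨i, Finset.mem_univ i⟩
  have hlt := Nat.find_spec (hex j)
  have hmin : ∀ j' l', A.start i k + 1 < A.start j' l' →
      A.start j (Nat.find (hex j)) ≤ A.start j' l' := fun j' l' h =>
    (hj j' (Finset.mem_univ _)).trans
      ((A.start_strictMono hc j').monotone (Nat.find_min' (hex j') h))
  refine ⟨(j, Nat.find (hex j)), ?_, hlt, hmin⟩
  rw [A.success_iff]
  rintro ⟨j', l', -, hs, h1, h2⟩
  have h3 := A.gap hc hk hs (by linarith)
  have h4 := hmin j' l' h3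
  linarith

/-- The successful retries from a given one on, in order. -/
lemma exists_enum [Fintype ι] (A : Run ι K c) (hc : 0 < c) {i : ι} {k : ℕ} (hk : A.success i k) :
    ∃ ev : ℕ → ι × ℕ, ev 0 = (i, k) ∧ (∀ t, A.success (ev t).1 (ev t).2) ∧
      (∀ t, A.start (ev t).1 (ev t).2 + 1 < A.start (ev (t + 1)).1 (ev (t + 1)).2) ∧
      (∀ t j l, A.start (ev t).1 (ev t).2 + 1 < A.start j l →
        A.start (ev (t + 1)).1 (ev (t + 1)).2 ≤ A.start j l) ∧
      ∀ j l, A.success j l → A.start i k ≤ A.start j l → ∃ t, ev t = (j, l) := by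
  classical
  choose nxt h1 h2 h3 using fun p : {p : ι × ℕ // A.success p.1 p.2} => A.exists_next hc p.2
  let ev : ℕ → {p : ι × ℕ // A.success p.1 p.2} := fun t =>
    (fun p => ⟨nxt p, h1 p⟩)^[t] ⟨(i, k), hk⟩
  have hev : ∀ t, (ev (t + 1)).1 = nxt (ev t) := fun t => by
    simp only [ev, Function.iterate_succ_apply']
  have hlt : ∀ t, A.start (ev t).1.1 (ev t).1.2 + 1 < A.start (ev (t + 1)).1.1 (ev (t + 1)).1.2 :=
    fun t => by rw [hev]; exact h2 _
  have hmin : ∀ t j l, A.start (ev t).1.1 (ev t).1.2 + 1 < A.start j l →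
        A.start (ev (t + 1)).1.1 (ev (t + 1)).1.2 ≤ A.start j l := fun t => by
    rw [hev]; exact h3 _
  refine ⟨fun t => (ev t).1, rfl, fun t => (ev t).2, hlt, hmin, ?_⟩
  intro j l hs hle
  have hgrow : ∀ t : ℕ, A.start i k + t ≤ A.start (ev t).1.1 (ev t).1.2 := by
    intro t
    induction t with
    | zero => simp [ev]
    | succ t ih =>
      have := hlt t
      push_cast
      linarith
  obtain ⟨m, hm⟩ := A.exists_lt j i l k
  have hex : ∃ t, A.start j l < A.start (ev t).1.1 (ev t).1.2 := ⟨m, hm.trans_le (hgrow m)⟩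
  have hs1 := Nat.find_spec hex
  have hpos : 0 < Nat.find hex := by
    rw [Nat.pos_iff_ne_zero]
    intro h0
    rw [h0] at hs1
    exact absurd hle (not_le.2 hs1)
  obtain ⟨t, ht⟩ : ∃ t, Nat.find hex = t + 1 := ⟨Nat.find hex - 1, by omega⟩
  have h4 := not_lt.1 (Nat.find_min hex (m := t) (by omega))
  rw [ht] at hs1
  refine ⟨t, ?_⟩
  rcases h4.lt_or_eq with h5 | h5
  · have := hmin t j l (A.gap hc (ev t).2 hs h5)
    exact absurd this (not_le.2 hs1)
  · obtain ⟨h6, h7⟩ := A.eq_of_start_eq hc h5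
    exact Prod.ext h6 h7

end Run
-- The periodic history before the insertion
/-- The starting times `R` of the last successful retries of all threads before a certain time, in
an execution that consists of a cyclic execution of period `T` to which thread `ν` is added. -/
structure History {K : Type*} [Field K] [LinearOrder K] {n : ℕ} (T : K) (f : ℕ)
    (ν : Fin (n + 1)) (R : Fin (n + 1) → K) : Prop where
  n_pos : 0 < n
  period_gt : (f : K) + 1 < T
  injective : Function.Injective R
  before : ∀ j ≠ ν, R j + 1 < R ν
  gap : ∀ i ≠ ν, ∀ j ≠ ν, R i < R j → R i + 1 < R j
  after : ∀ j ≠ ν, R ν < R j + T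
  -- The retry that starts `v` before a success of `j` fails, so a success of another old thread
  -- ends during it. The two alternatives express its position modulo the period.
  conflict : ∀ j ≠ ν, ∀ v : ℕ, 1 ≤ v → v ≤ f → ∃ i ≠ ν,
    (R j - v - 1 < R i ∧ R i < R j - v) ∨ (R j + T - v - 1 < R i ∧ R i < R j + T - v)

namespace History

variable {K : Type*} [Field K] [LinearOrder K] [IsStrictOrderedRing K] {n : ℕ} {T : K} {f : ℕ}
  {ν : Fin (n + 1)} {R : Fin (n + 1) → K}

/-- The threads, periodically, sorted by their times `R`. -/
def thread (R : Fin (n + 1) → K) (l : ℕ) : Fin (n + 1) :=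
  Tuple.sort R ⟨l % (n + 1), Nat.mod_lt _ (Nat.add_one_pos n)⟩

/-- The times `R`, repeated with period `T`. -/
def time (T : K) (R : Fin (n + 1) → K) (l : ℕ) : K := R (thread R l) + (l / (n + 1) : ℕ) * T

/-- The number of indices below `l` that belong to old threads. -/
def oldCount (n l : ℕ) : ℕ := l - l / (n + 1)

lemma succ_of_lt {l : ℕ} (h : l % (n + 1) < n) :
    (l + 1) / (n + 1) = l / (n + 1) ∧ (l + 1) % (n + 1) = l % (n + 1) + 1 := by
  have h1 : l + 1 = (l % (n + 1) + 1) + (n + 1) * (l / (n + 1)) := by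
    have := Nat.mod_add_div l (n + 1); omega
  have h2 : l % (n + 1) + 1 < n + 1 := by omega
  constructor
  · conv_lhs => rw [h1]
    rw [Nat.add_mul_div_left _ _ (Nat.add_one_pos n), Nat.div_eq_of_lt h2, zero_add]
  · conv_lhs => rw [h1]
    rw [Nat.add_mul_mod_self_left, Nat.mod_eq_of_lt h2]

lemma succ_of_eq {l : ℕ} (h : l % (n + 1) = n) :
    (l + 1) / (n + 1) = l / (n + 1) + 1 ∧ (l + 1) % (n + 1) = 0 := by
  have h1 : l + 1 = (n + 1) * (l / (n + 1) + 1) := by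
    have := Nat.mod_add_div l (n + 1)
    rw [mul_add, mul_one]
    omega
  constructor
  · rw [h1, Nat.mul_div_cancel_left _ (Nat.add_one_pos n)]
  · rw [h1, Nat.mul_mod_right]

lemma oldCount_succ_of_lt {l : ℕ} (h : l % (n + 1) < n) :
    oldCount n (l + 1) = oldCount n l + 1 := by
  unfold oldCount
  rw [(succ_of_lt h).1]
  have := Nat.div_le_self l (n + 1)
  omega

lemma oldCount_succ_of_eq {l : ℕ} (h : l % (n + 1) = n) :
    oldCount n (l + 1) = oldCount n l := by
  unfold oldCount
  rw [(succ_of_eq h).1]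
  omega

lemma oldCount_mono : Monotone (oldCount n) := by
  refine monotone_nat_of_le_succ fun l => ?_
  have := Nat.mod_lt l (Nat.add_one_pos n)
  rcases Nat.lt_or_ge (l % (n + 1)) n with h | h
  · rw [oldCount_succ_of_lt h]; omega
  · rw [oldCount_succ_of_eq (by omega)]

lemma oldCount_lt {l m : ℕ} (h : l % (n + 1) < n) (hlm : l < m) :
    oldCount n l < oldCount n m := by
  have h1 := oldCount_succ_of_lt h
  have h2 := oldCount_mono (n := n) (show l + 1 ≤ m from hlm)
  omega

lemma sorted (h : History T f ν R) : StrictMono (R ∘ Tuple.sort R) :=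
  (Tuple.monotone_sort R).strictMono_of_injective (h.injective.comp (Tuple.sort R).injective)

lemma sort_last (h : History T f ν R) : Tuple.sort R (Fin.last n) = ν := by
  by_contra hc
  have h1 := h.before _ hc
  have h2 := (Tuple.monotone_sort R) (Fin.le_last ((Tuple.sort R).symm ν))
  simp only [Function.comp_apply, Equiv.apply_symm_apply] at h2
  linarith

lemma thread_eq_iff (h : History T f ν R) (l : ℕ) : thread R l = ν ↔ l % (n + 1) = n := by
  unfold thread
  rw [← h.sort_last, (Tuple.sort R).injective.eq_iff, Fin.ext_iff]
  simp

lemma mod_lt_of_thread_ne (h : History T f ν R) {l : ℕ} (hl : thread R l ≠ ν) :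
    l % (n + 1) < n := by
  have := Nat.mod_lt l (Nat.add_one_pos n)
  have := mt (h.thread_eq_iff l).2 hl
  omega

lemma thread_add (l : ℕ) : thread R (l + (n + 1)) = thread R l := by
  unfold thread
  simp

lemma thread_inj {k l : ℕ} (hk : k < n + 1) (hl : l < n + 1) (he : thread R k = thread R l) :
    k = l := by
  have := (Tuple.sort R).injective he
  simpa [Fin.ext_iff, Nat.mod_eq_of_lt hk, Nat.mod_eq_of_lt hl] using this

lemma time_add (l : ℕ) : time T R (l + (n + 1)) = time T R l + T := by
  unfold time
  rw [thread_add, Nat.add_div_right _ (Nat.add_one_pos n)]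
  push_cast; ring

lemma oldCount_add (l : ℕ) : oldCount n (l + (n + 1)) = oldCount n l + n := by
  unfold oldCount
  rw [Nat.add_div_right _ (Nat.add_one_pos n)]
  have := Nat.div_le_self l (n + 1)
  omega

lemma time_succ_of_lt (h : History T f ν R) {l : ℕ} (hl : l % (n + 1) < n) :
    time T R l + 1 < time T R (l + 1) := by
  obtain ⟨h1, h2⟩ := succ_of_lt hl
  have hlt : R (thread R l) < R (thread R (l + 1)) := by
    apply h.sorted
    simp [Fin.lt_def, h2]
  have hne : thread R l ≠ ν := by rw [Ne, h.thread_eq_iff]; omega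
  have : R (thread R l) + 1 < R (thread R (l + 1)) := by
    by_cases h3 : thread R (l + 1) = ν
    · rw [h3]; exact h.before _ hne
    · exact h.gap _ hne _ h3 hlt
  unfold time
  rw [h1]
  linarith

lemma time_succ_of_eq (h : History T f ν R) {l : ℕ} (hl : l % (n + 1) = n) :
    time T R l < time T R (l + 1) := by
  obtain ⟨h1, h2⟩ := succ_of_eq hl
  have h3 : thread R (l + 1) ≠ ν := by
    rw [Ne, h.thread_eq_iff]
    have := h.n_pos
    omega
  have h4 := h.after _ h3
  unfold time
  rw [h1, (h.thread_eq_iff l).2 hl]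
  push_cast
  linarith

lemma time_strictMono (h : History T f ν R) : StrictMono (time T R) := by
  refine strictMono_nat_of_lt_succ fun l => ?_
  have := Nat.mod_lt l (Nat.add_one_pos n)
  rcases Nat.lt_or_ge (l % (n + 1)) n with hl | hl
  · linarith [h.time_succ_of_lt hl]
  · exact h.time_succ_of_eq (by omega)

/-- The times of the successes in virtual time, in which a retry lasts no time. -/
def pos (T : K) (R : Fin (n + 1) → K) (l : ℕ) : K := time T R l - oldCount n l - 2 * (T + 1)

lemma pos_strictMono (h : History T f ν R) : StrictMono (pos T R) := by
  refine strictMono_nat_of_lt_succ fun l => ?_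
  unfold pos
  have := Nat.mod_lt l (Nat.add_one_pos n)
  rcases Nat.lt_or_ge (l % (n + 1)) n with hl | hl
  · have := h.time_succ_of_lt hl
    rw [oldCount_succ_of_lt hl]
    push_cast
    linarith
  · have := h.time_succ_of_eq (l := l) (by omega)
    rw [oldCount_succ_of_eq (by omega)]
    linarith

lemma pos_add (l : ℕ) : pos T R (l + (n + 1)) = pos T R l + (T - n) := by
  unfold pos
  rw [time_add, oldCount_add]
  push_cast; ring

/-- The constant `2 * (T + 1)` in `pos` is chosen for this. Two rounds contribute `2 * T` to the
time, and the two fictitious earlier entries of `ν` are left out of `oldCount`; so in the third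
round the virtual time agrees with `σ l = start - l`. -/
lemma pos_eq {l : ℕ} (h1 : 2 * (n + 1) ≤ l) (h2 : l < 3 * (n + 1)) :
    pos T R l = R (thread R l) - l := by
  have h3 : l / (n + 1) = 2 := Nat.div_eq_of_lt_le (by omega) (by omega)
  unfold pos time oldCount
  rw [h3, Nat.cast_sub (by omega)]
  push_cast; ring

lemma time_zero_add_le (h : History T f ν R) {l : ℕ} (hl : l ≤ n) :
    time T R 0 + l ≤ time T R l := by
  induction l with
  | zero => simp
  | succ l ih =>
    have := h.time_succ_of_lt (l := l) (by rw [Nat.mod_eq_of_lt (by omega)]; omega)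
    have := ih (by omega)
    push_cast
    linarith

lemma n_lt_period (h : History T f ν R) : (n : K) < T := by
  have h1 := h.time_zero_add_le le_rfl
  have h2 := h.time_succ_of_eq (l := n) (Nat.mod_eq_of_lt (by omega))
  have h3 := time_add (T := T) (R := R) 0
  rw [zero_add] at h3
  linarith

lemma exists_conflict (h : History T f ν R) {k : ℕ} (hk : n + 1 ≤ k) (hkν : thread R k ≠ ν)
    (v : ℕ) (hv1 : 1 ≤ v) (hvf : v ≤ f) :
    ∃ m, m % (n + 1) < n ∧ time T R k - v - 1 < time T R m ∧ time T R m < time T R k - v := by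
  obtain ⟨i, hi, hR⟩ := h.conflict _ hkν v hv1 hvf
  set i' := (Tuple.sort R).symm i with hi'
  have hth : ∀ c : ℕ, thread R ((i' : ℕ) + (n + 1) * c) = i := by
    intro c
    unfold thread
    have : (⟨((i' : ℕ) + (n + 1) * c) % (n + 1), Nat.mod_lt _ (Nat.add_one_pos n)⟩ : Fin (n + 1)) = i' := by
      ext; simpa using Nat.lt_succ_iff.1 i'.2
    rw [this, hi']; simp
  have htime : ∀ c : ℕ, time T R ((i' : ℕ) + (n + 1) * c) = R i + c * T := by
    intro c
    unfold time
    rw [hth, Nat.add_mul_div_left _ _ (Nat.add_one_pos n), Nat.div_eq_of_lt i'.2, zero_add]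
  have hdiv : 1 ≤ k / (n + 1) := (Nat.one_le_div_iff (Nat.add_one_pos n)).2 hk
  have htk : time T R k = R (thread R k) + (k / (n + 1) : ℕ) * T := rfl
  rcases hR with ⟨h1, h2⟩ | ⟨h1, h2⟩
  · refine ⟨(i' : ℕ) + (n + 1) * (k / (n + 1)), h.mod_lt_of_thread_ne (by rwa [hth]), ?_, ?_⟩ <;>
    · rw [htime, htk]; linarith
  · refine ⟨(i' : ℕ) + (n + 1) * (k / (n + 1) - 1), h.mod_lt_of_thread_ne (by rwa [hth]), ?_, ?_⟩ <;>
    · rw [htime, htk, Nat.cast_sub hdiv]; push_cast; linarith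

/-- The conflicts for `v = 1, …, f` lie in disjoint unit intervals going back from `k`, so at least
`v` old successes occur from `g v` on and before `k`. A real distance below `v + 1` thus becomes a
virtual distance below `1`. -/
lemma exists_window_of_ne (h : History T f ν R) {k : ℕ} (hk : n + 1 ≤ k) (hkν : thread R k ≠ ν) :
    ∃ g : ℕ → ℕ, ∀ v, 1 ≤ v → v ≤ f → (g v) % (n + 1) < n ∧ time T R k - v - 1 < time T R (g v) ∧
      time T R (g v) < time T R k - v ∧ g v < k ∧ oldCount n (g v) + v ≤ oldCount n k := by
  choose! g h1 h2 h3 using h.exists_conflict hk hkν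
  have hlt : ∀ v, 1 ≤ v → v ≤ f → g v < k := by
    intro v hv hvf
    rw [← h.time_strictMono.lt_iff_lt]
    have := h3 v hv hvf
    have : (0 : K) ≤ v := by positivity
    linarith
  refine ⟨g, fun v hv hvf => ⟨h1 v hv hvf, h2 v hv hvf, h3 v hv hvf, hlt v hv hvf, ?_⟩⟩
  induction v, hv using Nat.le_induction with
  | base => exact oldCount_lt (h1 1 le_rfl hvf) (hlt 1 le_rfl hvf)
  | succ v hv ih =>
    have h4 := ih (by omega)
    have h5 : g (v + 1) < g v := by
      rw [← h.time_strictMono.lt_iff_lt]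
      have h6 := h3 (v + 1) (by omega) hvf
      have h7 := h2 v hv (by omega)
      push_cast at h6
      linarith
    have := oldCount_lt (h1 (v + 1) (by omega) hvf) h5
    omega

/-- The `f` conflicts before index `n + 1` all come after index `0`, since `T > f + 1`. Counting old
successes in one round leaves room for fewer than `n` of them. -/
lemma f_lt (h : History T f ν R) : f < n := by
  rcases Nat.eq_zero_or_pos f with rfl | hf
  · exact h.n_pos
  have hne : thread R (n + 1) ≠ ν := by
    rw [Ne, h.thread_eq_iff, Nat.mod_self]
    have := h.n_pos
    omega
  obtain ⟨g, hg⟩ := h.exists_window_of_ne le_rfl hne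
  obtain ⟨-, h2, -, -, h5⟩ := hg f hf le_rfl
  have h6 := time_add (T := T) (R := R) 0
  rw [zero_add] at h6
  have h7 : 0 < g f := by
    rw [← h.time_strictMono.lt_iff_lt]
    linarith [h.period_gt]
  have h8 := oldCount_lt (n := n) (l := 0) (by simpa using h.n_pos) h7
  have h9 := oldCount_add (n := n) 0
  simp only [zero_add] at h9
  omega

/-- The `f` preceding successes are at a distance of at most `1`. -/
lemma exists_window (h : History T f ν R) {k : ℕ} (hk : n + 1 ≤ k) :
    ∃ S : Finset ℕ, f ≤ S.card ∧ ∀ m ∈ S, m < k ∧ pos T R k ≤ pos T R m + 1 := by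
  classical
  -- Conflicts are known only for old threads. An entry of `ν` borrows those of the following entry,
  -- which is not earlier and has the same `oldCount`.
  obtain ⟨k', hk', hkν, hc, ht, hlt⟩ : ∃ k' ≥ n + 1, thread R k' ≠ ν ∧
      oldCount n k' = oldCount n k ∧ time T R k ≤ time T R k' ∧
      ∀ m < k', m % (n + 1) < n → m < k := by
    by_cases hkν : thread R k = ν
    · have hm := (h.thread_eq_iff k).1 hkν
      refine ⟨k + 1, by omega, ?_, oldCount_succ_of_eq hm, (h.time_succ_of_eq hm).le, ?_⟩
      · rw [Ne, h.thread_eq_iff, (succ_of_eq hm).2]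
        have := h.n_pos
        omega
      · intro m hm1 hm2
        rcases Nat.lt_succ_iff_lt_or_eq.1 hm1 with h1 | rfl
        · exact h1
        · omega
    · exact ⟨k, hk, hkν, rfl, le_rfl, fun m hm _ => hm⟩
  obtain ⟨g, hg⟩ := h.exists_window_of_ne hk' hkν
  refine ⟨(Finset.Icc 1 f).image g, ?_, ?_⟩
  · rw [Finset.card_image_of_injOn, Nat.card_Icc]
    · omega
    · intro a ha b hb hab
      simp only [Finset.coe_Icc, Set.mem_Icc] at ha hb
      obtain ⟨-, a1, a2, -⟩ := hg a ha.1 ha.2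
      obtain ⟨-, b1, b2, -⟩ := hg b hb.1 hb.2
      rw [hab] at a1 a2
      have e1 : (a : K) < b + 1 := by linarith
      have e2 : (b : K) < a + 1 := by linarith
      have e3 : a < b + 1 := by exact_mod_cast e1
      have e4 : b < a + 1 := by exact_mod_cast e2
      omega
  · intro m hm
    obtain ⟨v, hv, rfl⟩ := Finset.mem_image.1 hm
    rw [Finset.mem_Icc] at hv
    obtain ⟨h1, h2, -, h4, h5⟩ := hg v hv.1 hv.2
    refine ⟨hlt _ h4 h1, ?_⟩
    have : ((oldCount n (g v) + v : ℕ) : K) ≤ (oldCount n k : ℕ) := by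
      rw [hc] at h5; exact_mod_cast h5
    push_cast at this
    unfold pos
    linarith

end History
-- From the insertion to a greedy sequence
/-- The situation at the first success, in its retry `kν`, of a thread `ν` that is added to a
cyclic execution. The next retry that thread `j` starts is one of those that it would start after
a success at time `R j`. -/
structure Insertion {K : Type*} [Field K] [LinearOrder K] {n q : ℕ} {r : K}
    (A : Run (Fin (n + 1)) K (q + r)) (f : ℕ) (ν : Fin (n + 1)) (kν : ℕ)
    (R : Fin (n + 1) → K) : Prop extends History (1 + (q + r) + f) f ν R where
  success_new : A.success ν kν
  time_new : R ν = A.start ν kν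
  ready : ∀ j ≠ ν, ∃ κ u : ℕ, A.start j κ = R j + 1 + (q + r) + u ∧
    (u = 0 ∨ A.start j κ ≤ R ν + 1) ∧ R ν < A.start j κ ∧ ∀ κ' < κ, A.start j κ' < R ν

namespace Insertion

variable {K : Type*} [Field K] [LinearOrder K] [IsStrictOrderedRing K] {n q : ℕ} {r : K}
  {A : Run (Fin (n + 1)) K (q + r)} {f : ℕ} {ν : Fin (n + 1)} {kν : ℕ} {R : Fin (n + 1) → K}

open History

/-- The threads of the successes: the periodic history, followed by the enumeration `ev`. -/
def seqThread (R : Fin (n + 1) → K) (ev : ℕ → Fin (n + 1) × ℕ) (l : ℕ) : Fin (n + 1) :=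
  if l < 3 * n + 2 then thread R l else (ev (l - (3 * n + 2))).1

/-- The virtual times of the successes. -/
def seqPos (A : Run (Fin (n + 1)) K (q + r)) (f : ℕ) (R : Fin (n + 1) → K)
    (ev : ℕ → Fin (n + 1) × ℕ) (l : ℕ) : K :=
  if l < 3 * n + 2 then pos (1 + (q + r) + f) R l
  else A.start (ev (l - (3 * n + 2))).1 (ev (l - (3 * n + 2))).2 - l

/-- Index `3 * n + 2 = 3 * (n + 1) - 1` is the slot of `ν` that closes the third round. Its first
actual success `ev 0` is glued in there, so the sequence is periodic on its first `3 * (n + 1)`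
indices. -/
lemma last_mod : (3 * n + 2) % (n + 1) = n := by
  rw [show 3 * n + 2 = n + (n + 1) * 2 by ring, Nat.add_mul_mod_self_left,
    Nat.mod_eq_of_lt (by omega)]

lemma seqThread_add (R : Fin (n + 1) → K) (ev : ℕ → Fin (n + 1) × ℕ) (t : ℕ) :
    seqThread R ev (3 * n + 2 + t) = (ev t).1 := by
  unfold seqThread
  rw [if_neg (by omega), Nat.add_sub_cancel_left]

lemma seqPos_add (ev : ℕ → Fin (n + 1) × ℕ) (t : ℕ) :
    seqPos A f R ev (3 * n + 2 + t) = A.start (ev t).1 (ev t).2 - (3 * n + 2 + t : ℕ) := by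
  unfold seqPos
  rw [if_neg (by omega), Nat.add_sub_cancel_left]

lemma seqThread_of_lt (I : Insertion A f ν kν R) {ev : ℕ → Fin (n + 1) × ℕ}
    (h0 : ev 0 = (ν, kν)) {l : ℕ} (hl : l < 3 * (n + 1)) : seqThread R ev l = thread R l := by
  by_cases h : l < 3 * n + 2
  · unfold seqThread; rw [if_pos h]
  · obtain rfl : l = 3 * n + 2 + 0 := by omega
    rw [seqThread_add, h0, (I.thread_eq_iff _).2 last_mod]

lemma seqPos_of_lt (I : Insertion A f ν kν R) {ev : ℕ → Fin (n + 1) × ℕ}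
    (h0 : ev 0 = (ν, kν)) {l : ℕ} (hl : l < 3 * (n + 1)) :
    seqPos A f R ev l = pos (1 + (q + r) + f) R l := by
  by_cases h : l < 3 * n + 2
  · unfold seqPos; rw [if_pos h]
  · obtain rfl : l = 3 * n + 2 + 0 := by omega
    rw [seqPos_add, h0, pos_eq (by omega) (by omega), (I.thread_eq_iff _).2 last_mod, I.time_new]

/-- The retries of the thread of index `k`, after its last success before index `l`. -/
lemma exists_retry (I : Insertion A f ν kν R) (hc : 0 < q + r) {ev : ℕ → Fin (n + 1) × ℕ}
    (h0 : ev 0 = (ν, kν)) (hsucc : ∀ t, A.success (ev t).1 (ev t).2)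
    (hlt : ∀ t, A.start (ev t).1 (ev t).2 + 1 < A.start (ev (t + 1)).1 (ev (t + 1)).2)
    (hsurj : ∀ j l, A.success j l → A.start ν kν ≤ A.start j l → ∃ t, ev t = (j, l))
    {k t : ℕ} (hk : k < 3 * n + 2 + (t + 1))
    (hlast : ∀ m, k < m → m < 3 * n + 2 + (t + 1) → seqThread R ev m ≠ seqThread R ev k) :
    ∃ κ₀ u₀ : ℕ, A.start (seqThread R ev k) κ₀ =
        seqPos A f R ev k + k + 1 + (q + r) + u₀ ∧
      (∀ u : ℕ, A.start (ev t).1 (ev t).2 + 1 ≤ seqPos A f R ev k + k + 1 + (q + r) + u → u₀ ≤ u) ∧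
      (∀ κ ≥ κ₀, A.success (seqThread R ev k) κ →
        A.start (ev (t + 1)).1 (ev (t + 1)).2 ≤ A.start (seqThread R ev k) κ) ∧
      (∀ κ, ev (t + 1) = (seqThread R ev k, κ) → κ₀ ≤ κ) := by
  have hmono : StrictMono fun t => A.start (ev t).1 (ev t).2 :=
    strictMono_nat_of_lt_succ fun t => by linarith [hlt t]
  have hge : ∀ t, A.start ν kν ≤ A.start (ev t).1 (ev t).2 := by
    intro t
    have := hmono.monotone (Nat.zero_le t)
    simpa [h0] using this
  -- For `k` in the history, its thread is old and `k` lies in the third round, so `ready` supplies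
  -- the retries. Otherwise they start right after the parallel section that follows an actual
  -- success.
  by_cases hkb : k < 3 * n + 2
  · have hkν : thread R k ≠ ν := by
      intro h
      apply hlast (3 * n + 2 + 0) (by omega) (by omega)
      rw [seqThread_add, h0, I.seqThread_of_lt h0 (by omega), h]
    have hk2 : 2 * (n + 1) ≤ k := by
      by_contra hcon
      apply hlast (k + (n + 1)) (by omega) (by omega)
      rw [I.seqThread_of_lt h0 (by omega), I.seqThread_of_lt h0 (by omega), thread_add]
    have hp : seqPos A f R ev k + k = R (thread R k) := by
      rw [I.seqPos_of_lt h0 (by omega), pos_eq hk2 (by omega)]; ring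
    rw [hp, I.seqThread_of_lt h0 (show k < 3 * (n + 1) by omega)]
    rw [I.seqThread_of_lt h0 (show k < 3 * (n + 1) by omega)] at hlast
    obtain ⟨κ, u, h1, h2, h3, h4⟩ := I.ready _ hkν
    refine ⟨κ, u, h1, ?_, ?_, ?_⟩
    · intro u' hu'
      rcases h2 with rfl | h2
      · exact Nat.zero_le _
      · have := hge t
        have e : (u : K) ≤ u' := by rw [I.time_new] at h2; linarith
        exact_mod_cast e
    · intro κ' hκ' hs
      have h5 := (A.start_strictMono hc (thread R k)).monotone hκ'
      obtain ⟨t', ht'⟩ := hsurj _ _ hs (by rw [I.time_new] at h3; linarith)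
      have : t + 1 ≤ t' := by
        by_contra hcon
        apply hlast (3 * n + 2 + t') (by omega) (by omega)
        rw [seqThread_add, ht']
      have := hmono.monotone this
      simpa [ht'] using this
    · intro κ' hκ'
      by_contra hcon
      have h5 := h4 κ' (not_le.1 hcon)
      have h6 := hge (t + 1)
      rw [hκ'] at h6
      rw [I.time_new] at h5
      exact absurd h6 (not_le.2 h5)
  · obtain ⟨s, rfl⟩ := Nat.exists_eq_add_of_le (not_lt.1 hkb)
    rw [seqThread_add] at hlast ⊢
    rw [seqPos_add]
    have h1 := hsucc s
    refine ⟨(ev s).2 + 1, 0, ?_, fun _ _ => Nat.zero_le _, ?_, ?_⟩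
    · rw [A.start_succ_of_success _ _ h1]; push_cast; ring
    · intro κ hκ hs
      have h2 := A.start_strictMono hc (ev s).1 (show (ev s).2 < κ by omega)
      obtain ⟨t', ht'⟩ := hsurj _ _ hs (by linarith [hge s])
      have h3 : s < t' := by
        rw [← hmono.lt_iff_lt]
        simpa [ht'] using h2
      have : t + 1 ≤ t' := by
        by_contra hcon
        apply hlast (3 * n + 2 + t') (by omega) (by omega)
        rw [seqThread_add, ht']
      have := hmono.monotone this
      simpa [ht'] using this
    · intro κ hκ
      have h2 := hmono (show s < t + 1 by omega)
      simp only [hκ] at h2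
      exact (A.start_strictMono hc _).lt_iff_lt.1 h2

lemma greedySeq (I : Insertion A f ν kν R) (hr0 : 0 < r) (hr1 : r < 1)
    (harch : ∃ t : ℕ, 1 ≤ t * r) {ev : ℕ → Fin (n + 1) × ℕ}
    (h0 : ev 0 = (ν, kν)) (hsucc : ∀ t, A.success (ev t).1 (ev t).2)
    (hlt : ∀ t, A.start (ev t).1 (ev t).2 + 1 < A.start (ev (t + 1)).1 (ev (t + 1)).2)
    (hmin : ∀ t j l, A.start (ev t).1 (ev t).2 + 1 < A.start j l →
        A.start (ev (t + 1)).1 (ev (t + 1)).2 ≤ A.start j l)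
    (hsurj : ∀ j l, A.success j l → A.start ν kν ≤ A.start j l → ∃ t, ev t = (j, l)) :
    GreedySeq r q f (q + 1 + f - n) (n + 1) (seqThread R ev) (seqPos A f R ev) := by
  classical
  have hq : (0 : K) ≤ q := by positivity
  have hc : 0 < q + r := by linarith
  have hn : n ≤ q + 1 + f := by
    have := I.n_lt_period
    have : (n : K) < q + f + 2 := by linarith
    have : n < q + f + 2 := by exact_mod_cast this
    omega
  have hΓ : r + (q + 1 + f - n : ℕ) = 1 + (q + r) + f - n := by
    rw [Nat.cast_sub hn]; push_cast; ring
  refine ⟨by simp, by omega, by have := I.f_lt; omega, hr0, hr1, ?_, ?_, ?_, ?_, ?_, ?_, ?_, ?_⟩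
  · obtain ⟨t, ht⟩ := harch
    refine ⟨1 + (q + 1 + f - n) * t, ?_⟩
    have h1 : ((q + 1 + f - n : ℕ) : K) * 1 ≤ (q + 1 + f - n : ℕ) * (t * r) :=
      mul_le_mul_of_nonneg_left ht (Nat.cast_nonneg _)
    rw [Nat.cast_add, Nat.cast_mul, Nat.cast_one]
    linarith
  · refine strictMono_nat_of_lt_succ fun l => ?_
    rcases Nat.lt_or_ge l (3 * n + 2) with hl | hl
    · rw [I.seqPos_of_lt h0 (by omega), I.seqPos_of_lt h0 (by omega)]
      exact I.pos_strictMono (Nat.lt_succ_self l)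
    · obtain ⟨t, rfl⟩ := Nat.exists_eq_add_of_le hl
      rw [add_assoc (3 * n + 2), seqPos_add, seqPos_add]
      have := hlt t
      push_cast
      linarith
  · intro k l hk hl he
    rw [I.seqThread_of_lt h0 (by omega), I.seqThread_of_lt h0 (by omega)] at he
    exact thread_inj hk hl he
  · intro k hk
    rw [I.seqThread_of_lt h0 (by omega), I.seqThread_of_lt h0 (by omega), thread_add]
  · intro k hk
    rw [I.seqPos_of_lt h0 (by omega), I.seqPos_of_lt h0 (by omega), pos_add, hΓ]
  · intro k hk1 hk2
    obtain ⟨S, hS, hSm⟩ := I.exists_window hk1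
    refine ⟨S, hS, fun m hm => ?_⟩
    obtain ⟨h1, h2⟩ := hSm m hm
    rw [I.seqPos_of_lt h0 hk2, I.seqPos_of_lt h0 (by omega)]
    exact ⟨h1, h2⟩
  · intro l hl k hkl hlast u hu
    obtain ⟨t, rfl⟩ : ∃ t, l = 3 * n + 2 + (t + 1) := ⟨l - (3 * n + 3), by omega⟩
    obtain ⟨κ₀, u₀, e1, e2, e3, -⟩ := I.exists_retry hc h0 hsucc hlt hsurj hkl hlast
    rw [show 3 * n + 2 + (t + 1) - 1 = 3 * n + 2 + t by omega, seqPos_add] at hu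
    rw [seqPos_add, seqThread_add]
    have hu' : A.start (ev t).1 (ev t).2 + 1 ≤ seqPos A f R ev k + k + 1 + (q + r) + u := by
      push_cast at hu ⊢; linarith
    obtain ⟨w, rfl⟩ := Nat.exists_eq_add_of_le (e2 u hu')
    have hY : seqPos A f R ev k + r + (k + 1 + q + (u₀ + w : ℕ)) - (3 * n + 2 + (t + 1) : ℕ)
        = A.start (seqThread R ev k) κ₀ + w - (3 * n + 2 + (t + 1) : ℕ) := by
      rw [e1]; push_cast; ring
    rw [hY, sub_le_sub_iff_right, sub_left_inj]
    have hu2 : A.start (ev t).1 (ev t).2 + 1 ≤ A.start (seqThread R ev k) κ₀ + w := by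
      rw [e1]; push_cast at hu' ⊢; linarith
    -- If the thread does not succeed before the candidate, the candidate is an actual retry and
    -- `hmin` applies. Otherwise the candidate is not a retry at all, but the earlier success of the
    -- thread already bounds `ev (t + 1)`, strictly.
    by_cases hf : ∀ κ, κ₀ ≤ κ → κ < κ₀ + w → ¬ A.success (seqThread R ev k) κ
    · have h1 := A.start_add_of_failures _ κ₀ w hf
      rw [← h1] at hu2 ⊢
      have h2 := lt_of_le_of_ne hu2 (A.start_ne_add_one hc (hsucc t)).symm
      exact ⟨hmin t _ _ h2, fun h => (A.eq_of_start_eq hc h).1⟩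
    · push Not at hf
      have hex : ∃ κ, κ₀ ≤ κ ∧ A.success (seqThread R ev k) κ := by
        obtain ⟨κ, h1, -, h2⟩ := hf
        exact ⟨κ, h1, h2⟩
      obtain ⟨κ, h1, h2, h3⟩ := hf
      have hfind := Nat.find_spec hex
      obtain ⟨v, hv⟩ := Nat.exists_eq_add_of_le hfind.1
      have hvle := Nat.find_min' hex ⟨h1, h3⟩
      have hst := A.start_add_of_failures (seqThread R ev k) κ₀ v (fun κ' h4 h5 h6 =>
        Nat.find_min hex (m := κ') (by omega) ⟨h4, h6⟩)
      have h7 := e3 _ hfind.1 hfind.2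
      rw [hv, hst] at h7
      have h8 : (v : K) < w := by
        have : v < w := by omega
        exact_mod_cast this
      exact ⟨by linarith, fun h => by linarith⟩
  · intro l hl k hkl he hlast
    obtain ⟨t, rfl⟩ : ∃ t, l = 3 * n + 2 + (t + 1) := ⟨l - (3 * n + 3), by omega⟩
    obtain ⟨κ₀, u₀, e1, -, e3, e4⟩ := I.exists_retry hc h0 hsucc hlt hsurj hkl hlast
    rw [seqThread_add] at he
    have hev : ev (t + 1) = (seqThread R ev k, (ev (t + 1)).2) := by rw [← he]
    have h1 := e4 _ hev
    obtain ⟨v, hv⟩ := Nat.exists_eq_add_of_le h1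
    have hst := A.start_add_of_failures (seqThread R ev k) κ₀ v (fun κ' h4 h5 h6 => by
      have h7 := e3 κ' h4 h6
      have h8 := A.start_strictMono hc (seqThread R ev k) h5
      rw [← hv, ← he] at h8
      rw [← he] at h7
      linarith)
    refine ⟨u₀ + v, ?_⟩
    rw [seqPos_add, he, hv, hst, e1]
    push_cast
    ring

/-- Eventually, every thread succeeds after the same number of failures, `f` or `f + 1`. -/
theorem eventually_const (I : Insertion A f ν kν R) (hr0 : 0 < r) (hr1 : r < 1)
    (harch : ∃ t : ℕ, 1 ≤ t * r) :
    ∃ F, (F = f ∨ F = f + 1) ∧ ∃ (i₀ : Fin (n + 1)) (k₀ : ℕ),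
      (∀ j, ∃ k, A.success j k ∧ A.start i₀ k₀ ≤ A.start j k) ∧
      ∀ j k, A.success j k → A.start i₀ k₀ ≤ A.start j k →
        (∀ u, 1 ≤ u → u ≤ F → ¬ A.success j (k + u)) ∧ A.success j (k + F + 1) := by
  have hq : (0 : K) ≤ q := by positivity
  have hc : 0 < q + r := by linarith
  obtain ⟨ev, h0, hsucc, hlt, hmin, hsurj⟩ := A.exists_enum hc I.success_new
  have hG := I.greedySeq hr0 hr1 harch h0 hsucc hlt hmin hsurj
  have hmono : StrictMono fun t => A.start (ev t).1 (ev t).2 :=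
    strictMono_nat_of_lt_succ fun t => by linarith [hlt t]
  have hge : ∀ t, A.start ν kν ≤ A.start (ev t).1 (ev t).2 := by
    intro t
    have := hmono.monotone (Nat.zero_le t)
    simpa [h0] using this
  obtain ⟨F, hF, k₀, hk₀⟩ := hG.eventually_const
  refine ⟨F, hF, (ev k₀).1, (ev k₀).2, ?_, ?_⟩
  · intro j
    obtain ⟨k, hk, hj⟩ := hG.exists_th_eq_ge j (3 * n + 2 + k₀)
    obtain ⟨t, rfl⟩ := Nat.exists_eq_add_of_le (show 3 * n + 2 ≤ k by omega)
    rw [seqThread_add] at hj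
    subst hj
    exact ⟨_, hsucc t, hmono.monotone (by omega)⟩
  · intro j k hs hle
    obtain ⟨t, ht⟩ := hsurj j k hs ((hge k₀).trans hle)
    have htk : k₀ ≤ t := by
      rw [← hmono.le_iff_le]
      simpa [ht] using hle
    obtain ⟨l, ⟨hl1, hl2, hl3⟩, hl4⟩ := hk₀ (3 * n + 2 + t) (by omega)
    obtain ⟨s, rfl⟩ := Nat.exists_eq_add_of_le (show 3 * n + 2 ≤ l by omega)
    rw [seqThread_add, seqThread_add, ht] at hl2
    rw [seqPos_add, seqPos_add, ht, hl2] at hl4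
    simp only at hl2 hl4
    have hbet : ∀ κ, k < κ → κ < (ev s).2 → ¬ A.success j κ := by
      intro κ h1 h2 h3
      have h4 := A.start_strictMono hc j h1
      have h5 := A.start_strictMono hc j h2
      obtain ⟨t', ht'⟩ := hsurj j κ h3 (((hge k₀).trans hle).trans h4.le)
      have h6 : t < t' := by
        rw [← hmono.lt_iff_lt]
        simpa [ht, ht'] using h4
      have h7 : t' < s := by
        rw [← hmono.lt_iff_lt]
        simpa [ht', hl2] using h5
      apply hl3 (3 * n + 2 + t') (by omega) (by omega)
      rw [seqThread_add, seqThread_add, ht, ht']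
    have hks : k < (ev s).2 := by
      have := hmono (show t < s by omega)
      simp only [ht, hl2] at this
      exact (A.start_strictMono hc j).lt_iff_lt.1 this
    obtain ⟨v, hv⟩ := Nat.exists_eq_add_of_le (show k + 1 ≤ (ev s).2 from hks)
    have hst := A.start_add_of_failures j (k + 1) v (fun κ h1 h2 => hbet κ (by omega) (by omega))
    rw [A.start_succ_of_success j k hs] at hst
    rw [hv, hst] at hl4
    have hvF : v = F := by
      have : (v : K) = F := by push_cast at hl4; linarith
      exact_mod_cast this
    subst hvF
    refine ⟨fun u h1 h2 => hbet _ (by omega) (by omega), ?_⟩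
    have := hsucc s
    rw [hl2, hv] at this
    rwa [show k + v + 1 = k + 1 + v by ring]

end Insertion
-- Separating simultaneous events by infinitesimals
/-- The time `s` of an event of thread `i`, increased by an infinitesimal that encodes the thread
number. -/
noncomputable def key {P : ℕ} (s : ℝ) (i : Fin P) : ℝ* := s + (i : ℕ) * Hyperreal.epsilon

lemma coe_natCast_hyperreal (m : ℕ) : ((m : ℝ) : ℝ*) = m := map_natCast Hyperreal.coeRingHom m

lemma key_add {P : ℕ} (s t : ℝ) (i : Fin P) : key (s + t) i = key s i + t := by
  unfold key
  rw [Hyperreal.coe_add]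
  ring

lemma key_add_one {P : ℕ} (s : ℝ) (i : Fin P) : key (s + 1) i = key s i + 1 := by
  rw [key_add, Hyperreal.coe_one]

/-- The thread numbers are below `P`, so their infinitesimal contribution is less than the real
number `t - s`. -/
lemma key_lt_of_lt {P : ℕ} {s t : ℝ} (i j : Fin P) (h : s < t) : key s i < key t j := by
  unfold key
  have hP : (0 : ℝ) < P := by
    have := i.pos
    exact_mod_cast this
  have h1 : Hyperreal.epsilon < ((t - s) / P : ℝ) :=
    Hyperreal.epsilon_lt_of_pos (div_pos (by linarith) hP)
  have h2 : ((P : ℝ) : ℝ*) * Hyperreal.epsilon < ((P : ℝ) : ℝ*) * ((t - s) / P : ℝ) :=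
    mul_lt_mul_of_pos_left h1 (Hyperreal.coe_pos.2 hP)
  rw [← Hyperreal.coe_mul, mul_div_cancel₀ _ hP.ne', Hyperreal.coe_sub,
    coe_natCast_hyperreal] at h2
  have h3 : ((i : ℕ) : ℝ*) * Hyperreal.epsilon ≤ P * Hyperreal.epsilon :=
    mul_le_mul_of_nonneg_right (by exact_mod_cast i.2.le) Hyperreal.epsilon_pos.le
  have h4 : 0 ≤ ((j : ℕ) : ℝ*) * Hyperreal.epsilon :=
    mul_nonneg (Nat.cast_nonneg _) Hyperreal.epsilon_pos.le
  linarith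

lemma key_lt_key_iff {P : ℕ} {s t : ℝ} {i j : Fin P} : key s i < key t j ↔ Before s i t j := by
  rcases lt_trichotomy s t with h | rfl | h
  · exact iff_of_true (key_lt_of_lt i j h) (Or.inl h)
  · unfold key Before
    rw [add_lt_add_iff_left, mul_lt_mul_iff_left₀ Hyperreal.epsilon_pos, Nat.cast_lt]
    simp
  · refine iff_of_false (key_lt_of_lt j i h).not_gt ?_
    rintro (h' | ⟨h', -⟩) <;> linarith

lemma key_inj {P : ℕ} {s t : ℝ} {i j : Fin P} (h : key s i = key t j) : s = t ∧ i = j := by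
  have h1 := h.not_lt
  have h2 := h.not_gt
  rw [key_lt_key_iff] at h1
  have h3 : ¬ Before t j s i := by rw [← key_lt_key_iff]; exact h2
  unfold Before at h1 h3
  push Not at h1 h3
  have h4 := le_antisymm h3.1 h1.1
  exact ⟨h4, le_antisymm (h3.2 h4.symm) (h1.2 h4)⟩

lemma le_of_key_lt {P : ℕ} {s t : ℝ} {i j : Fin P} (h : key s i < key t j) : s ≤ t := by
  rcases key_lt_key_iff.1 h with h | ⟨h, -⟩ <;> linarith

/-- An execution, in which the events that occur at the same instant are separated by
infinitesimals. Thread `i` has the number `e i`. -/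
noncomputable def Execution.toRun {q : ℕ} {r : ℝ} {P M : ℕ} (E : Execution q r P)
    (e : Fin P ↪o Fin M) : Run (Fin P) ℝ* (q + r) where
  start i k := key (E.start i k) (e i)
  success := E.success
  start_succ_of_success i k h := by
    rw [E.start_succ_of_success i k h, key_add, key_add_one, Hyperreal.coe_add,
      coe_natCast_hyperreal]
  start_succ_of_failure i k h := by
    rw [E.start_succ_of_failure i k h, key_add_one]
  success_iff i k := by
    have hb : ∀ (s t : ℝ) (i j : Fin P), Before s i t j ↔ Before s (e i) t (e j) := by
      intro s t i j
      simp [Before]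
    simp only [← key_add_one, key_lt_key_iff, ← hb]
    exact E.success_iff i k
  start_ne i j hij k l m h := by
    rw [← coe_natCast_hyperreal, ← key_add] at h
    exact hij (e.injective (key_inj h).2)
  exists_lt i j k l := by
    obtain ⟨m, hm⟩ := exists_nat_gt (E.start i k - E.start j l)
    refine ⟨m, ?_⟩
    rw [← coe_natCast_hyperreal, ← key_add]
    exact key_lt_of_lt _ _ (by linarith)

namespace Run

variable {K : Type*} [Field K] [LinearOrder K] [IsStrictOrderedRing K] {c : K} {n : ℕ}

lemma start_eq_of_agree {A : Run (Fin n) K c} {A' : Run (Fin (n + 1)) K c} {ν : Fin (n + 1)}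
    (hinit : ∀ i, A'.start (ν.succAbove i) 0 = A.start i 0) {i : Fin n} {k : ℕ}
    (h : ∀ l < k, A'.start (ν.succAbove i) l = A.start i l ∧
      (A'.success (ν.succAbove i) l ↔ A.success i l)) :
    A'.start (ν.succAbove i) k = A.start i k := by
  cases k with
  | zero => exact hinit i
  | succ k =>
    obtain ⟨h1, h2⟩ := h k (Nat.lt_succ_self k)
    by_cases hs : A.success i k
    · rw [A.start_succ_of_success i k hs, A'.start_succ_of_success _ k (h2.2 hs), h1]
    · rw [A.start_succ_of_failure i k hs, A'.start_succ_of_failure _ k (mt h2.1 hs), h1]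

/-- As long as the new thread has no success, the old threads are not affected. -/
lemma agree {A : Run (Fin n) K c} {A' : Run (Fin (n + 1)) K c} (hc : 0 < c) {ν : Fin (n + 1)}
    (hinit : ∀ i, A'.start (ν.succAbove i) 0 = A.start i 0) {x : K}
    (hx : ∀ k, A'.success ν k → x ≤ A'.start ν k) (i : Fin n) (k : ℕ) (hik : A.start i k < x) :
    A'.start (ν.succAbove i) k = A.start i k ∧
      (A'.success (ν.succAbove i) k ↔ A.success i k) := by
  classical
  by_contra hcon
  let bad : Fin n → ℕ → Prop := fun i k => A.start i k < x ∧
    ¬ (A'.start (ν.succAbove i) k = A.start i k ∧ (A'.success (ν.succAbove i) k ↔ A.success i k))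
  let first : Fin n → ℕ := fun i => if h : ∃ k, bad i k then Nat.find h else 0
  have hfirst : ∀ i, (∃ k, bad i k) → bad i (first i) ∧ ∀ k, bad i k → first i ≤ k := by
    intro i h
    simp only [first, dif_pos h]
    exact ⟨Nat.find_spec h, fun k hk => Nat.find_min' h hk⟩
  obtain ⟨i₀, hi₀, hmin⟩ := Finset.exists_min_image
    (Finset.univ.filter fun i => ∃ k, bad i k) (fun i => A.start i (first i))
    ⟨i, by simpa using ⟨k, hik, hcon⟩⟩
  simp only [Finset.mem_filter, Finset.mem_univ, true_and] at hi₀ hmin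
  obtain ⟨⟨hbx, hbad⟩, -⟩ := hfirst i₀ hi₀
  set k₀ := first i₀
  have hgood : ∀ j l, A.start j l < A.start i₀ k₀ → A'.start (ν.succAbove j) l = A.start j l ∧
      (A'.success (ν.succAbove j) l ↔ A.success j l) := by
    intro j l hl
    by_contra hb
    have hb' : bad j l := ⟨hl.trans hbx, hb⟩
    have h1 := hmin j ⟨l, hb'⟩
    have h2 := (A.start_strictMono hc j).monotone ((hfirst j ⟨l, hb'⟩).2 l hb')
    linarith
  have hst : A'.start (ν.succAbove i₀) k₀ = A.start i₀ k₀ :=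
    start_eq_of_agree hinit fun l hl => hgood i₀ l (A.start_strictMono hc i₀ hl)
  refine hbad ⟨hst, ?_⟩
  -- At a bad event with the earliest start, the outcome depends only on successes that end before
  -- this retry does. These start earlier and are good, while a success of `ν` ends at `x + 1` or
  -- later, which is too late.
  rw [A.success_iff, A'.success_iff, not_iff_not, hst]
  constructor
  · rintro ⟨j', l, hj, hs, h1, h2⟩
    rcases Fin.eq_self_or_eq_succAbove ν j' with rfl | ⟨j, rfl⟩
    · have := hx l hs
      linarith
    -- Otherwise take the first retry of `j` in the old execution that does not start before the bad
    -- event: its start still agrees in both executions, so the retry `l` of the new one starts too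
    -- late as well.
    have hlt : A.start j l < A.start i₀ k₀ := by
      by_contra hge
      have hex : ∃ l, A.start i₀ k₀ ≤ A.start j l := ⟨l, not_lt.1 hge⟩
      have h3 : A'.start (ν.succAbove j) (Nat.find hex) = A.start j (Nat.find hex) :=
        start_eq_of_agree hinit fun m hm => hgood j m (not_le.1 (Nat.find_min hex hm))
      have h4 := Nat.find_spec hex
      have h5 := (A'.start_strictMono hc (ν.succAbove j)).monotone
        (Nat.find_min' hex (not_lt.1 hge))
      linarith
    obtain ⟨h3, h4⟩ := hgood j l hlt
    rw [h3] at h1 h2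
    exact ⟨j, l, fun h => hj (by rw [h]), h4.1 hs, h1, h2⟩
  · rintro ⟨j, l, hj, hs, h1, h2⟩
    obtain ⟨h3, h4⟩ := hgood j l (by linarith)
    refine ⟨ν.succAbove j, l, fun h => hj (Fin.succAbove_right_injective h), h4.2 hs, ?_, ?_⟩ <;>
    rwa [h3]

end Run
end LockFree

/-! ### Consequences of cyclicity -/

namespace LockFree
namespace Execution

variable {q : ℕ} {r : ℝ} {n : ℕ}

lemma start_strictMono (E : Execution q r n) (hc : 0 < q + r) (i : Fin n) :
    StrictMono (E.start i) :=
  strictMono_nat_of_lt_succ fun k => by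
    by_cases h : E.success i k
    · rw [E.start_succ_of_success i k h]; linarith
    · rw [E.start_succ_of_failure i k h]; linarith

lemma start_add_of_failures (E : Execution q r n) (i : Fin n) (k m : ℕ)
    (h : ∀ l, k ≤ l → l < k + m → ¬ E.success i l) : E.start i (k + m) = E.start i k + m := by
  induction m with
  | zero => simp
  | succ m ih =>
    rw [← add_assoc, E.start_succ_of_failure _ _ (h _ (by omega) (by omega)),
      ih fun l h1 h2 => h l h1 (by omega)]
    push_cast; ring

namespace IsCyclicFrom

variable {E : Execution q r n} {f : ℕ} {τ : ℝ}

lemma periodicFrom (hE : E.IsCyclicFrom f τ) : E.PeriodicFrom τ (1 + q + r + f) := hE.1.1.2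

lemma period_pos (hE : E.IsCyclicFrom f τ) : 0 < 1 + (q : ℝ) + r + f := hE.1.1.1

lemma pos (hE : E.IsCyclicFrom f τ) : 0 < n := by
  rw [Nat.pos_iff_ne_zero]
  rintro rfl
  have h1 := hE.period_pos
  have h2 := hE.1.2 (show (1 + (q : ℝ) + r + f) / 2 ∈ _ from ⟨by linarith, fun _ _ i => i.elim0⟩)
  linarith

lemma success_unique (hE : E.IsCyclicFrom f τ) {i : Fin n} {s : ℝ} (hs : τ ≤ s) {k l : ℕ}
    (hk : E.success i k) (hl : E.success i l) (hk1 : s ≤ E.start i k)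
    (hk2 : E.start i k < s + (1 + q + r + f)) (hl1 : s ≤ E.start i l)
    (hl2 : E.start i l < s + (1 + q + r + f)) : k = l :=
  (hE.2 i s hs).unique ⟨hk, hk1, hk2⟩ ⟨hl, hl1, hl2⟩

/-- A successful retry, and what follows it until the next successful retry. -/
lemma next_success (hE : E.IsCyclicFrom f τ) (hc : 0 < q + r) {i : Fin n} {k : ℕ}
    (hk : E.success i k) (hτ : τ ≤ E.start i k) :
    E.success i (k + f + 1) ∧ E.start i (k + f + 1) = E.start i k + (1 + q + r + f) ∧
      ∀ u, 1 ≤ u → u ≤ f → ¬ E.success i (k + u) ∧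
        E.start i (k + u) = E.start i k + (1 + q + r + f) - (f + 1 - u) := by
  have hT := hE.period_pos
  obtain ⟨k', hk', he, -⟩ := (hE.periodicFrom _ hτ i (.successfulRetry 0)).2
    ⟨k, hk, by simp, le_rfl, one_pos⟩
  rw [add_zero] at he
  have hmono := E.start_strictMono hc i
  have hlt : k < k' := by
    rw [← hmono.lt_iff_lt]; linarith
  have hfail : ∀ m, k < m → m < k' → ¬ E.success i m := by
    intro m h1 h2 h3
    have h4 := hmono h1
    have h5 := hmono h2
    have := hE.success_unique hτ hk h3 le_rfl (by linarith) h4.le (by linarith)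
    omega
  obtain ⟨v, rfl⟩ := Nat.exists_eq_add_of_le (show k + 1 ≤ k' from hlt)
  have hst : ∀ m ≤ v, E.start i (k + 1 + m) = E.start i k + 1 + (q + r) + m := by
    intro m hm
    rw [E.start_add_of_failures i (k + 1) m (fun l h1 h2 => hfail l (by omega) (by omega)),
      E.start_succ_of_success i k hk]
  have hv : v = f := by
    have h1 := hst v le_rfl
    have : (v : ℝ) = f := by linarith
    exact_mod_cast this
  subst hv
  rw [show k + v + 1 = k + 1 + v by ring]
  refine ⟨hk', he.symm, fun u h1 h2 => ⟨hfail _ (by omega) (by omega), ?_⟩⟩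
  have := hst (u - 1) (by omega)
  rw [show k + 1 + (u - 1) = k + u by omega, Nat.cast_sub h1] at this
  rw [this]
  push_cast
  ring

lemma add_le_of_success (hE : E.IsCyclicFrom f τ) (hc : 0 < q + r) {i : Fin n} {k l : ℕ}
    (hk : E.success i k) (hτ : τ ≤ E.start i k) (hl : E.success i l) (hkl : k < l) :
    k + f + 1 ≤ l := by
  by_contra hcon
  have := ((hE.next_success hc hk hτ).2.2 (l - k) (by omega) (by omega)).1
  rw [Nat.add_sub_cancel' hkl.le] at this
  exact this hl

/-- The `f` retries before the success one period later are failures that start at known times; one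
of them is shifted back by a period. -/
lemma exists_start_sub (hE : E.IsCyclicFrom f τ) (hc : 0 < q + r) {i : Fin n} {k : ℕ}
    (hk : E.success i k) {v : ℕ} (hv1 : 1 ≤ v) (hvf : v ≤ f) (hτ : τ ≤ E.start i k - v) :
    ∃ m, E.start i m = E.start i k - v := by
  have hv0 : (0 : ℝ) ≤ v := by positivity
  obtain ⟨h1, h2⟩ := (hE.next_success hc hk (by linarith)).2.2 (f + 1 - v) (by omega) (by omega)
  obtain ⟨m, -, hm, -⟩ := (hE.periodicFrom _ hτ i (.unsuccessfulRetry 0)).1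
    ⟨_, h1, by rw [h2, Nat.cast_sub (by omega)]; push_cast; ring, le_rfl, one_pos⟩
  exact ⟨m, by linarith⟩

/-- After more than `f` failures in a row, a suitable one of them, repeated one period later, would
start strictly between the start of the success and the start of the next retry. -/
lemma exists_success_le (hE : E.IsCyclicFrom f τ) (hc : 0 < q + r) {i : Fin n} {k : ℕ}
    (hτ : τ ≤ E.start i k) : ∃ w ≤ f, E.success i (k + w) := by
  classical
  have hmono := E.start_strictMono hc i
  obtain ⟨l, ⟨hl, hl1, -⟩, -⟩ := hE.2 i _ hτ
  have hex : ∃ w, E.success i (k + w) :=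
    ⟨l - k, by rwa [Nat.add_sub_cancel' (hmono.le_iff_le.1 hl1)]⟩
  refine ⟨Nat.find hex, ?_, Nat.find_spec hex⟩
  by_contra hcon
  obtain ⟨v, hv⟩ := Nat.exists_eq_add_of_le (show f + 1 ≤ Nat.find hex by omega)
  have hfail : ∀ m, k ≤ m → m < k + Nat.find hex → ¬ E.success i m := fun m h1 h2 h3 =>
    Nat.find_min hex (m := m - k) (by omega) (by rwa [Nat.add_sub_cancel' h1])
  have hs := Nat.find_spec hex
  rw [hv] at hs hfail
  have e1 := E.start_add_of_failures i k v (fun m h1 h2 => hfail m h1 (by omega))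
  have e2 := E.start_add_of_failures i k (f + 1 + v) hfail
  have hv0 : (0 : ℝ) ≤ v := by positivity
  obtain ⟨m, -, hm, -⟩ := (hE.periodicFrom (E.start i (k + v)) (by linarith) i
    (.unsuccessfulRetry 0)).2 ⟨k + v, hfail _ (by omega) (by omega), by simp, le_rfl, one_pos⟩
  have e3 := E.start_succ_of_success i _ hs
  push_cast at e2
  have h1 : k + (f + 1 + v) < m := by
    rw [← hmono.lt_iff_lt]; linarith
  have h2 : m < k + (f + 1 + v) + 1 := by
    rw [← hmono.lt_iff_lt]; linarith
  omega

/-- The earlier success may start before `τ` as long as it ends no earlier than `τ`. It is then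
recovered from the state at time `τ`: in the middle of the retry or, in the boundary case, at the
very beginning of the parallel section. -/
lemma exists_prev_success (hE : E.IsCyclicFrom f τ) (hc : 0 < q + r) {i : Fin n} {k : ℕ}
    (hk : E.success i k) (hτ : τ ≤ E.start i k - (1 + q + r + f) + 1) :
    ∃ l, E.success i l ∧ E.start i l = E.start i k - (1 + q + r + f) := by
  rcases le_or_gt τ (E.start i k - (1 + q + r + f)) with h | h
  · obtain ⟨l, hl, he, -⟩ := (hE.periodicFrom _ h i (.successfulRetry 0)).1
      ⟨k, hk, by ring, le_rfl, one_pos⟩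
    exact ⟨l, hl, by linarith⟩
  rcases hτ.lt_or_eq with h' | h'
  · obtain ⟨l, hl, he, -⟩ := (hE.periodicFrom τ le_rfl i
      (.successfulRetry (τ - (E.start i k - (1 + q + r + f))))).1
      ⟨k, hk, by ring, by linarith, by linarith⟩
    exact ⟨l, hl, by linarith⟩
  · obtain ⟨l, hl, he, -⟩ := (hE.periodicFrom τ le_rfl i (.parallelSection 0)).1
      ⟨k, hk, by linarith, le_rfl, hc⟩
    exact ⟨l, hl, by linarith⟩

/-- Within `J` periods there are `n * J` successes, no two of them at a distance less than `1`. -/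
lemma card_mul_lt (hE : E.IsCyclicFrom f τ) (hc : 0 < q + r) (J : ℕ) :
    ((n * J : ℕ) : ℝ) < J * (1 + q + r + f) + 1 := by
  classical
  have hT := hE.period_pos
  set T : ℝ := 1 + q + r + f with hTdef
  let A := E.toRun (RelEmbedding.refl _)
  have hcK : (0 : ℝ*) < q + r := by
    have := Hyperreal.coe_pos.2 hc
    rwa [Hyperreal.coe_add, coe_natCast_hyperreal] at this
  have hex : ∀ (i : Fin n) (m : ℕ), ∃ k, E.success i k ∧ τ + m * T ≤ E.start i k ∧
      E.start i k < τ + m * T + T := fun i m => (hE.2 i _ (by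
        have : 0 ≤ m * T := by positivity
        linarith)).exists
  choose k h1 h2 h3 using hex
  have hgap : ∀ i m i' m', A.start i (k i m) < A.start i' (k i' m') →
      E.start i (k i m) + 1 ≤ E.start i' (k i' m') := by
    intro i m i' m' h
    have h4 := A.gap hcK (h1 i m) (h1 i' m') h
    rw [show A.start i (k i m) + 1 = key (E.start i (k i m) + 1) i from
      (key_add_one _ _).symm] at h4
    exact le_of_key_lt h4
  -- Successes are at least `1` apart, so the integer parts of their times since `τ` are distinct.
  have hcard := Finset.card_le_card_of_injOn
    (s := (Finset.univ : Finset (Fin n)) ×ˢ Finset.range J) (t := Finset.range ⌈J * T⌉₊)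
    (fun p => ⌊E.start p.1 (k p.1 p.2) - τ⌋₊) ?_ ?_
  · rw [Finset.card_product, Finset.card_univ, Fintype.card_fin, Finset.card_range,
      Finset.card_range] at hcard
    have := Nat.ceil_lt_add_one (show 0 ≤ J * T by positivity)
    have h4 : ((n * J : ℕ) : ℝ) ≤ ⌈J * T⌉₊ := by exact_mod_cast hcard
    linarith
  · rintro ⟨i, m⟩ hm
    simp only [Finset.coe_product, Finset.coe_univ, Finset.coe_range, Set.mem_prod,
      Set.mem_univ, true_and, Set.mem_Iio] at hm ⊢
    have h4 : ((m + 1 : ℕ) : ℝ) ≤ J := by exact_mod_cast hm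
    have h5 : ((m + 1 : ℕ) : ℝ) * T ≤ J * T := mul_le_mul_of_nonneg_right h4 hT.le
    push_cast at h5
    have h6 : E.start i (k i m) - τ < J * T := by linarith [h3 i m]
    have h7 : 0 ≤ E.start i (k i m) - τ := by
      have : 0 ≤ m * T := by positivity
      linarith [h2 i m]
    have h8 := (Nat.floor_le h7).trans_lt (h6.trans_le (Nat.le_ceil _))
    exact_mod_cast h8
  · rintro ⟨i, m⟩ - ⟨i', m'⟩ - he
    simp only at he
    have h4 : ∀ i m, 0 ≤ E.start i (k i m) - τ := by
      intro i m
      have : 0 ≤ m * T := by positivity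
      linarith [h2 i m]
    have h5 := Nat.floor_le (h4 i m)
    have h6 := Nat.floor_le (h4 i' m')
    have h7 := Nat.lt_floor_add_one (E.start i (k i m) - τ)
    have h8 := Nat.lt_floor_add_one (E.start i' (k i' m') - τ)
    rw [he] at h5 h7
    rcases lt_trichotomy (A.start i (k i m)) (A.start i' (k i' m')) with h9 | h9 | h9
    · linarith [hgap _ _ _ _ h9]
    · obtain ⟨rfl, h10⟩ := A.eq_of_start_eq hcK h9
      have a1 := h2 i m
      have a2 := h3 i m
      have b1 := h2 i m'
      have b2 := h3 i m'
      rw [h10] at a1 a2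
      have c1 : (m : ℝ) * T < (m' + 1) * T := by linarith
      have c2 : (m' : ℝ) * T < (m + 1) * T := by linarith
      have d1 := lt_of_mul_lt_mul_right c1 hT.le
      have d2 := lt_of_mul_lt_mul_right c2 hT.le
      have e1 : m < m' + 1 := by exact_mod_cast d1
      have e2 : m' < m + 1 := by exact_mod_cast d2
      ext
      · rfl
      · simp only; omega
    · linarith [hgap _ _ _ _ h9]

/-- Letting the number of periods grow in `card_mul_lt` removes the boundary term `1` and gives `≤`.
Equality fails because the period is not an integer. -/
lemma card_lt_period (hE : E.IsCyclicFrom f τ) (hr0 : 0 < r) (hr1 : r < 1) :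
    (n : ℝ) < 1 + q + r + f := by
  have hq : (0 : ℝ) ≤ q := by positivity
  have hle : (n : ℝ) ≤ 1 + q + r + f := by
    by_contra hcon
    obtain ⟨J, hJ⟩ := exists_nat_gt (1 / ((n : ℝ) - (1 + q + r + f)))
    have h1 := hE.card_mul_lt (by linarith) J
    rw [div_lt_iff₀ (by linarith)] at hJ
    push_cast at h1
    linarith
  refine lt_of_le_of_ne hle fun h => ?_
  have h1 : ((1 + q + f : ℕ) : ℝ) < n := by push_cast; linarith
  have h2 : (n : ℝ) < (1 + q + f + 1 : ℕ) := by push_cast; linarith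
  have h3 : 1 + q + f < n := by exact_mod_cast h1
  have h4 : n < 1 + q + f + 1 := by exact_mod_cast h2
  omega

end IsCyclicFrom
end Execution

/-! ### The first success of the new thread -/

namespace Execution

variable {q : ℕ} {r : ℝ} {n : ℕ}

lemma coe_period (q f : ℕ) (r : ℝ) :
    ((1 + q + r + f : ℝ) : ℝ*) = 1 + ((q : ℝ*) + r) + f := by
  simp only [Hyperreal.coe_add, coe_natCast_hyperreal, Hyperreal.coe_one]
  ring

lemma key_add_nat {P : ℕ} (s : ℝ) (m : ℕ) (i : Fin P) : key (s + m) i = key s i + m := by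
  rw [key_add, coe_natCast_hyperreal]

/-- The new thread succeeds at some time. -/
lemma exists_success_new {f : ℕ} {τ a : ℝ} {E : Execution q r n} {E' : Execution q r (n + 1)}
    {ν : Fin (n + 1)} (hE : E.IsCyclicFrom f τ) (hr0 : 0 < r) (hr1 : r < 1) (ha : τ ≤ a)
    (hadd : E.AddsThread E' ν a) : ∃ k, E'.success ν k := by
  classical
  by_contra hcon
  push Not at hcon
  have hq : (0 : ℝ) ≤ q := by positivity
  have hc : 0 < q + r := by linarith
  have hcK : (0 : ℝ*) < q + r := by
    have := Hyperreal.coe_pos.2 hc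
    rwa [Hyperreal.coe_add, coe_natCast_hyperreal] at this
  let A := E.toRun (Fin.succAboveOrderEmb ν)
  let A' := E'.toRun (RelEmbedding.refl _)
  have hinit : ∀ i, A'.start (ν.succAbove i) 0 = A.start i 0 := fun i =>
    congrArg (fun s => key s (ν.succAbove i)) (hadd.2 i)
  have hν : ∀ k : ℕ, E'.start ν k = a + k := by
    intro k
    have := E'.start_add_of_failures ν 0 k (fun l _ _ => hcon l)
    rwa [zero_add, hadd.1] at this
  have hex : ∀ k : ℕ, ∃ (j : Fin n) (l : ℕ), E.success j l ∧ key (a + k) ν < A.start j l ∧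
      A.start j l < key (a + k) ν + 1 := by
    intro k
    have h1 := mt (A'.success_iff ν (k + 1)).2 (hcon (k + 1))
    rw [not_not] at h1
    obtain ⟨j', l, hj, hs, h2, h3⟩ := h1
    have h4 : A'.start ν (k + 1) = key (a + k) ν + 1 := by
      change key (E'.start ν (k + 1)) ν = _
      rw [hν, ← key_add_one]
      push_cast
      rw [add_assoc]
    rw [h4] at h2 h3
    rcases Fin.eq_self_or_eq_succAbove ν j' with rfl | ⟨j, rfl⟩
    · exact absurd rfl hj
    obtain ⟨h5, h6⟩ := A.agree (A' := A') hcK hinit (x := A.start j l + 1)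
      (fun k hk => absurd hk (hcon k)) j l (by linarith)
    rw [h5] at h2 h3
    exact ⟨j, l, h6.1 hs, by linarith, by linarith⟩
  choose j l hs h1 h2 using hex
  have hb1 : ∀ k : ℕ, a + k ≤ E.start (j k) (l k) := fun k => le_of_key_lt (h1 k)
  have hb2 : ∀ k : ℕ, E.start (j k) (l k) ≤ a + k + 1 := by
    intro k
    have := h2 k
    rw [← key_add_one] at this
    exact le_of_key_lt this
  have hT := hE.period_pos
  have hn := hE.card_lt_period hr0 hr1
  set T : ℝ := 1 + q + r + f with hTdef
  -- Every failure of the new thread, after its first retry, requires its own old success. Over `J`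
  -- periods that makes `n * J + 1` of them, as `J * T > n * J + 1`, but only `n * J` are available.
  obtain ⟨J, hJ⟩ := exists_nat_gt (1 / (T - n))
  rw [div_lt_iff₀ (by linarith)] at hJ
  have hfl : ∀ k, 0 ≤ (E.start (j k) (l k) - a) / T := fun k =>
    div_nonneg (by have := hb1 k; have : (0 : ℝ) ≤ k := by positivity
                   linarith) hT.le
  obtain ⟨k₁, -, k₂, -, hne, heq⟩ := Finset.exists_ne_map_eq_of_card_lt_of_maps_to
    (s := Finset.range (n * J + 1)) (t := (Finset.univ : Finset (Fin n)) ×ˢ Finset.range J)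
    (f := fun k => (j k, ⌊(E.start (j k) (l k) - a) / T⌋₊))
    (by rw [Finset.card_product, Finset.card_univ, Fintype.card_fin, Finset.card_range,
          Finset.card_range]
        exact Nat.lt_succ_self _)
    (by
      intro k hk
      simp only [Finset.coe_range, Set.mem_Iio] at hk
      simp only [Finset.coe_product, Finset.coe_univ, Finset.coe_range, Set.mem_prod,
        Set.mem_univ, true_and, Set.mem_Iio]
      rw [Nat.floor_lt (hfl k), div_lt_iff₀ hT]
      have h3 : ((k + 1 : ℕ) : ℝ) ≤ (n * J + 1 : ℕ) := by exact_mod_cast hk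
      push_cast at h3
      linarith [hb2 k])
  simp only [Prod.mk.injEq] at heq
  obtain ⟨hj, hm⟩ := heq
  wlog hlt : k₁ < k₂ generalizing k₁ k₂
  · exact this k₂ k₁ hne.symm hj.symm hm.symm (lt_of_le_of_ne (not_lt.1 hlt) hne.symm)
  have f1 := Nat.floor_le (hfl k₁)
  have f2 := Nat.lt_floor_add_one ((E.start (j k₁) (l k₁) - a) / T)
  have f3 := Nat.floor_le (hfl k₂)
  have f4 := Nat.lt_floor_add_one ((E.start (j k₂) (l k₂) - a) / T)
  rw [hm] at f1 f2
  set m := ⌊(E.start (j k₂) (l k₂) - a) / T⌋₊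
  rw [le_div_iff₀ hT] at f1 f3
  rw [div_lt_iff₀ hT] at f2 f4
  have hm0 : 0 ≤ m * T := by positivity
  have hl : l k₁ = l k₂ := by
    have h3 := hs k₁
    rw [hj] at h3 f1 f2
    exact hE.success_unique (s := a + m * T) (by linarith) h3 (hs k₂) (by linarith)
      (by linarith) (by linarith) (by linarith)
  have h3 := h2 k₁
  have h4 := h1 k₂
  rw [hj, hl] at h3
  rw [← key_add_one] at h3
  have h5 : ((k₁ + 1 : ℕ) : ℝ) ≤ k₂ := by exact_mod_cast hlt
  push_cast at h5
  have h6 := key_lt_key_iff.1 (h4.trans h3)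
  rcases h6 with h6 | ⟨-, h6⟩
  · linarith
  · exact lt_irrefl _ h6

/-- The first success of the new thread is an insertion. -/
lemma exists_insertion {f : ℕ} {τ a : ℝ} {E : Execution q r n} {E' : Execution q r (n + 1)}
    {ν : Fin (n + 1)} (hE : E.IsCyclicFrom f τ) (hr0 : 0 < r) (hr1 : r < 1) (ha : τ ≤ a)
    (hadd : E.AddsThread E' ν a) :
    ∃ kν R, Insertion (E'.toRun (RelEmbedding.refl _)) f ν kν R := by
  classical
  have hq : (0 : ℝ) ≤ q := by positivity
  have hc : 0 < q + r := by linarith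
  have hcK : (0 : ℝ*) < q + r := by
    have := Hyperreal.coe_pos.2 hc
    rwa [Hyperreal.coe_add, coe_natCast_hyperreal] at this
  have hexν := exists_success_new hE hr0 hr1 ha hadd
  set kν := Nat.find hexν
  have hsν : E'.success ν kν := Nat.find_spec hexν
  set A := E.toRun (Fin.succAboveOrderEmb ν) with hA
  set A' := E'.toRun (RelEmbedding.refl _) with hA'
  set xr := E'.start ν kν with hxr
  set x : ℝ* := key xr ν with hx
  have hxτ : τ ≤ xr := by
    have := (E'.start_strictMono hc ν).monotone (Nat.zero_le kν)
    rw [hadd.1] at this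
    exact ha.trans this
  have hinit : ∀ i, A'.start (ν.succAbove i) 0 = A.start i 0 := fun i =>
    congrArg (fun s => key s (ν.succAbove i)) (hadd.2 i)
  have hagree := A.agree (A' := A') hcK hinit (x := x) (fun k hk =>
    (A'.start_strictMono hcK ν).monotone (Nat.find_min' hexν hk))
  have hAs : ∀ i k, A.start i k = key (E.start i k) (ν.succAbove i) := fun _ _ => rfl
  have hneν : ∀ i, ν.succAbove i ≠ ν := fun i => Fin.succAbove_ne ν i
  have hkne : ∀ (s : ℝ) i, key s (ν.succAbove i) ≠ x := fun s i h => hneν i (key_inj h).2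
  have hT := hE.period_pos
  have hTK := coe_period q f r
  set T : ℝ := 1 + q + r + f with hTdef
  -- the first success of each old thread after `x`
  have hexB : ∀ i, ∃ k, E.success i k ∧ x < A.start i k := by
    intro i
    obtain ⟨k, hk, hk1, -⟩ := (hE.2 i (xr + 1) (by linarith)).exists
    exact ⟨k, hk, by rw [hAs]; exact key_lt_of_lt _ _ (by linarith)⟩
  obtain ⟨k, hk1, hk2, hkmin⟩ : ∃ k : Fin n → ℕ, (∀ i, E.success i (k i)) ∧
      (∀ i, x < A.start i (k i)) ∧ ∀ i l, E.success i l → x < A.start i l → k i ≤ l :=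
    ⟨fun i => Nat.find (hexB i), fun i => (Nat.find_spec (hexB i)).1,
      fun i => (Nat.find_spec (hexB i)).2, fun i l h1 h2 => Nat.find_min' (hexB i) ⟨h1, h2⟩⟩
  have hτB : ∀ i, τ ≤ E.start i (k i) := fun i => hxτ.trans (le_of_key_lt (hk2 i))
  -- For an old thread, the first success after `x` moved back by one period. It need not have taken
  -- place in the execution, as the cyclic regime may have started later.
  let R : Fin (n + 1) → ℝ* := fun j =>
    key (ν.insertNth (α := fun _ => ℝ) xr (fun i => E.start i (k i) - T) j) j
  have hRν : R ν = x := by simp [R, hx]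
  have hRi : ∀ i, R (ν.succAbove i) = key (E.start i (k i) - T) (ν.succAbove i) := by
    intro i; simp [R]
  have hRB : ∀ i, R (ν.succAbove i) + (1 + ((q : ℝ*) + r) + f) = A.start i (k i) := by
    intro i
    rw [hRi, ← hTK, ← key_add, hAs, sub_add_cancel]
  have hbefore : ∀ i, R (ν.succAbove i) + 1 < x := by
    intro i
    by_contra hcon
    -- Otherwise the retry one period before `k i` ends after `x`, so it really exists. It starts
    -- before `x`, so its CAS falls inside the successful retry of `ν`.
    rw [hRi, ← key_add_one] at hcon
    have h1 := lt_of_le_of_ne (not_lt.1 hcon) (hkne _ i).symm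
    obtain ⟨l, hl, hle⟩ := hE.exists_prev_success hc (hk1 i)
      (hxτ.trans (le_of_key_lt h1))
    have h2 : A.start i l < x := by
      by_contra h3
      have h4 := hkmin i l hl (lt_of_le_of_ne (not_lt.1 h3) (hkne _ i).symm)
      have := (E.start_strictMono hc i).monotone h4
      linarith
    obtain ⟨h3, h4⟩ := hagree i l h2
    refine (A'.success_iff ν kν).1 hsν ⟨_, l, hneν i, h4.2 hl, ?_, ?_⟩
    · rw [h3, hAs, hle, ← key_add_one]
      exact h1
    · rw [h3]
      exact add_lt_add_left h2 1
  refine ⟨kν, R, ⟨⟨hE.pos, ?_, ?_, ?_, ?_, ?_, ?_⟩, hsν, hRν, ?_⟩⟩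
  · linarith
  · intro i j h
    exact (key_inj h).2
  · intro j hj
    obtain ⟨i, rfl⟩ := Fin.exists_succAbove_eq hj
    rw [hRν]
    exact hbefore i
  · intro j hj j' hj' h
    obtain ⟨i, rfl⟩ := Fin.exists_succAbove_eq hj
    obtain ⟨i', rfl⟩ := Fin.exists_succAbove_eq hj'
    have h1 := A.gap hcK (hk1 i) (hk1 i') (by rw [← hRB, ← hRB]; linarith)
    rw [← hRB, ← hRB] at h1
    linarith
  · intro j hj
    obtain ⟨i, rfl⟩ := Fin.exists_succAbove_eq hj
    rw [hRν, hRB]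
    exact hk2 i
  · intro j hj v hv1 hvf
    obtain ⟨i, rfl⟩ := Fin.exists_succAbove_eq hj
    -- The failure is taken before the success that follows `k i`, so that cyclicity certainly
    -- applies to it.
    obtain ⟨h1, h2⟩ := (hE.next_success hc (hk1 i) (hτB i)).2.2 (f + 1 - v) (by omega) (by omega)
    have h3 := mt (A.success_iff i _).2 h1
    rw [not_not] at h3
    obtain ⟨i', l, hne, hl, h4, h5⟩ := h3
    have h6 : A.start i (k i + (f + 1 - v)) =
        R (ν.succAbove i) + 2 * (1 + ((q : ℝ*) + r) + f) - v := by
      rw [hAs, h2, Nat.cast_sub (by omega), ← hTdef]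
      rw [show E.start i (k i) + T - ((f : ℝ) + 1 - ((f + 1 : ℕ) - (v : ℝ)))
        = E.start i (k i) + T + (-v : ℝ) by push_cast; ring]
      rw [key_add, key_add, ← hAs, ← hRB, hTK, Hyperreal.coe_neg, coe_natCast_hyperreal]
      ring
    rw [h6] at h4 h5
    have hvK : (v : ℝ*) ≤ f := by exact_mod_cast hvf
    have hv0 : (0 : ℝ*) ≤ v := by positivity
    have hB := hRB i
    have hB' := hRB i'
    have hx1 := hk2 i
    have hx1' := hk2 i'
    have hx2 := hbefore i
    have hxl : x < A.start i' l := by linarith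
    have hkl := hkmin i' l hl hxl
    -- The conflicting success starts after `x` and less than two periods after the start of `k i'`,
    -- so it is the first or the second success of `i'` after `x`.
    have hl2 : l = k i' ∨ l = k i' + f + 1 := by
      by_contra hcon
      push Not at hcon
      have g1 := hE.add_le_of_success hc (hk1 i') (hτB i') hl (by omega)
      have n1 := hE.next_success hc (hk1 i') (hτB i')
      have n2 := hE.next_success hc n1.1 (by rw [n1.2.1]; linarith [hτB i'])
      have g2 := hE.add_le_of_success hc n1.1 (by rw [n1.2.1]; linarith [hτB i']) hl (by omega)
      have g3 := (A.start_strictMono hcK i').monotone g2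
      have g4 : A.start i' (k i' + f + 1 + f + 1) =
          A.start i' (k i') + 2 * (1 + ((q : ℝ*) + r) + f) := by
        rw [hAs, n2.2.1, n1.2.1, key_add, key_add, ← hAs, ← hTdef, hTK]
        ring
      linarith
    refine ⟨_, hneν i', ?_⟩
    rcases hl2 with rfl | rfl
    · right
      constructor <;> linarith
    · left
      have n1 := hE.next_success hc (hk1 i') (hτB i')
      have g4 : A.start i' (k i' + f + 1) = A.start i' (k i') + (1 + ((q : ℝ*) + r) + f) := by
        rw [hAs, n1.2.1, key_add, ← hAs, ← hTdef, hTK]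
      constructor <;> linarith
  · intro j hj
    obtain ⟨i, rfl⟩ := Fin.exists_succAbove_eq hj
    have hex : ∃ κ, x < A.start i κ := ⟨_, hk2 i⟩
    set κ := Nat.find hex with hκ
    have hκ1 : x < A.start i κ := Nat.find_spec hex
    have hκ2 : ∀ κ' < κ, A.start i κ' < x := fun κ' h =>
      lt_of_le_of_ne (not_lt.1 (Nat.find_min hex h)) (hkne _ i)
    have hst : A'.start (ν.succAbove i) κ = A.start i κ :=
      Run.start_eq_of_agree hinit fun l hl => hagree i l (hκ2 l hl)
    have hκk : κ ≤ k i := Nat.find_min' hex (hk2 i)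
    obtain ⟨v, hv⟩ := Nat.exists_eq_add_of_le hκk
    have hτκ : τ ≤ E.start i κ := hxτ.trans (le_of_key_lt hκ1)
    have hmono := A.start_strictMono hcK i
    have hvf : v ≤ f := by
      obtain ⟨w, hw, hsw⟩ := hE.exists_success_le hc hτκ
      have := hkmin i _ hsw (hκ1.trans_le (hmono.monotone (Nat.le_add_right κ w)))
      omega
    have hBv := E.start_add_of_failures i κ v (fun l h1 h2 h3 => by
      have := hkmin i l h3 (hκ1.trans_le (hmono.monotone h1))
      omega)
    rw [← hv] at hBv
    -- Success `k i` comes after exactly `f` failures counted from `R`; since `κ` is `v` retries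
    -- before it, `f - v` failures precede `κ`.
    refine ⟨κ, f - v, ?_, ?_, ?_, ?_⟩
    · have h1 := hRB i
      rw [hAs, hBv, key_add_nat, ← hAs] at h1
      rw [hst, Nat.cast_sub hvf]
      linarith
    · rcases hvf.lt_or_eq with hvf | rfl
      -- If `κ` started more than `1` after `x`, the periodic pattern would provide another retry
      -- starting `1` earlier, still after `x`, against the choice of `κ`.
      · right
        by_contra hcon
        rw [hst, hRν, hAs] at hcon
        have h1 := not_le.1 hcon
        have h2 : x < key (E.start i κ - 1) (ν.succAbove i) := by
          have h3 := key_add_one (E.start i κ - 1) (ν.succAbove i)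
          rw [sub_add_cancel] at h3
          linarith
        have h3 := hxτ.trans (le_of_key_lt h2)
        obtain ⟨m, hm⟩ := hE.exists_start_sub hc (hk1 i) (v := v + 1) (by omega) hvf
          (by push_cast; linarith)
        have h4 : E.start i m = E.start i κ - 1 := by
          rw [hm, hBv]; push_cast; ring
        have h5 : κ ≤ m := Nat.find_min' hex (by rw [hAs, h4]; exact h2)
        have := (E.start_strictMono hc i).monotone h5
        linarith
      · left; omega
    · rw [hRν, hst]; exact hκ1
    · intro κ' hκ'
      have h1 := hκ2 κ' hκ'
      rw [hRν, (hagree i κ' h1).1]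
      exact h1

end Execution

/-! ### From a constant number of failures to a cyclic execution -/

namespace Execution

variable {q : ℕ} {r : ℝ} {P : ℕ}

lemma le_start_iff_of_phase (E : Execution q r P) (hc : 0 < q + r) {i : Fin P} {k l : ℕ} {t : ℝ}
    (ht : E.start i k ≤ t) (hl : t < E.start i (l + 1)) : k ≤ l := by
  have := (E.start_strictMono hc i).lt_iff_lt.1 (ht.trans_lt hl)
  omega

/-- An execution in which each thread eventually succeeds after exactly `F` failures is eventually
cyclic. -/
theorem isCyclicFrom_of_regular (E : Execution q r P) (hP : 0 < P) (hc : 0 < q + r) (F : ℕ)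
    (k₀ : Fin P → ℕ) (h0 : ∀ i, E.success i (k₀ i))
    (hreg : ∀ i k, k₀ i ≤ k → E.success i k →
      (∀ u, 1 ≤ u → u ≤ F → ¬ E.success i (k + u)) ∧ E.success i (k + F + 1)) :
    ∃ τ, E.IsCyclicFrom F τ := by
  classical
  set T : ℝ := 1 + q + r + F with hTdef
  have hF0 : (0 : ℝ) ≤ F := by positivity
  have hT : 0 < T := by linarith
  have hmono := E.start_strictMono hc
  -- the successes of a thread
  have hsucc : ∀ i m, E.success i (k₀ i + m * (F + 1)) := by
    intro i m
    induction m with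
    | zero => simpa using h0 i
    | succ m ih =>
      have := (hreg i _ (by omega) ih).2
      rwa [show k₀ i + (m + 1) * (F + 1) = k₀ i + m * (F + 1) + F + 1 by ring]
  have hper : ∀ i k, k₀ i ≤ k → (E.success i (k + F + 1) ↔ E.success i k) := by
    intro i k hk
    refine ⟨fun h => ?_, fun h => (hreg i k hk h).2⟩
    by_contra hcon
    obtain ⟨m, hm⟩ := Nat.exists_eq_add_of_le hk
    have h1 := Nat.div_add_mod' m (F + 1)
    have h2 := Nat.mod_lt m (Nat.succ_pos F)
    set x := m / (F + 1)
    set y := m % (F + 1)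
    have hy : y ≠ 0 := by
      rintro hy
      apply hcon
      have := hsucc i x
      rwa [show k₀ i + x * (F + 1) = k by omega] at this
    have h3 := (hreg i _ (by nlinarith) (hsucc i (x + 1))).1 y (by omega) (by omega)
    -- A retry that is not a multiple of `F + 1` past `k₀ i` lies among the `F` failures following a
    -- success, and so does the one `F + 1` later.
    rw [show k₀ i + (x + 1) * (F + 1) + y = k + F + 1 by rw [add_mul]; omega] at h3
    exact h3 h
  have hnext : ∀ i k, k₀ i ≤ k → E.success i k → E.start i (k + F + 1) = E.start i k + T := by
    intro i k hk hs
    have h1 := E.start_add_of_failures i (k + 1) F (fun l h2 h3 => by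
      have := (hreg i k hk hs).1 (l - k) (by omega) (by omega)
      rwa [Nat.add_sub_cancel' (by omega)] at this)
    rw [show k + F + 1 = k + 1 + F by ring, h1, E.start_succ_of_success i k hs]
    ring
  have hstart : ∀ i k, k₀ i ≤ k → E.start i (k + F + 1) = E.start i k + T := by
    intro i k hk
    induction k, hk using Nat.le_induction with
    | base => exact hnext i _ le_rfl (h0 i)
    | succ k hk ih =>
      rw [show k + 1 + F + 1 = k + F + 1 + 1 by ring]
      by_cases hs : E.success i k
      · rw [E.start_succ_of_success _ _ hs, E.start_succ_of_success _ _ ((hper i k hk).2 hs), ih]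
        ring
      · rw [E.start_succ_of_failure _ _ hs,
          E.start_succ_of_failure _ _ (mt (hper i k hk).1 hs), ih]
        ring
  have hstart_mul : ∀ i m, E.start i (k₀ i + m * (F + 1)) = E.start i (k₀ i) + m * T := by
    intro i m
    induction m with
    | zero => simp
    | succ m ih =>
      rw [show k₀ i + (m + 1) * (F + 1) = k₀ i + m * (F + 1) + F + 1 by ring,
        hstart i _ (by omega), ih]
      push_cast; ring
  let i₀ : Fin P := ⟨0, hP⟩
  obtain ⟨i₁, -, hmax⟩ := Finset.exists_max_image Finset.univ (fun i => E.start i (k₀ i))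
    ⟨i₀, Finset.mem_univ _⟩
  set τ := E.start i₁ (k₀ i₁)
  have hτ : ∀ i, E.start i (k₀ i) ≤ τ := fun i => hmax i (Finset.mem_univ i)
  have hphase : ∀ i k (s : Prop), (s ↔ E.success i k) → ∀ t x, t = E.start i k + x →
      (x < 1 ∨ s ∧ x < 1 + (q + r)) → t < E.start i (k + 1) := by
    intro i k s hs t x ht hx
    by_cases h : E.success i k
    · rw [E.start_succ_of_success _ _ h]
      rcases hx with hx | ⟨-, hx⟩ <;> linarith
    · rw [E.start_succ_of_failure _ _ h]
      rcases hx with hx | ⟨h', -⟩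
      · linarith
      · exact absurd (hs.1 h') h
  -- the retry of a state
  have key : ∀ (S : Fin P → ℕ → Prop), (∀ i k, k₀ i ≤ k → (S i (k + F + 1) ↔ S i k)) →
      ∀ (I : ℝ → Prop), (∀ i k t x, S i k → I x → t = E.start i k + x → t < E.start i (k + 1)) →
      ∀ t, τ ≤ t → ∀ i, ∀ x, I x → ((∃ k, S i k ∧ t + T = E.start i k + x) ↔
        ∃ k, S i k ∧ t = E.start i k + x) := by
    intro S hS I hI t ht i x hx
    constructor
    · rintro ⟨k, hk, he⟩
      have h1 := hI i k _ x hk hx he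
      -- The retry seen at `t + T` has an index of at least `k₀ i + F + 1`, so it can be shifted
      -- back by a whole period.
      have h2 := E.le_start_iff_of_phase hc (k := k₀ i + F + 1) (t := t + T)
        (by rw [hstart i _ le_rfl]; linarith [hτ i]) h1
      obtain ⟨m, rfl⟩ := Nat.exists_eq_add_of_le h2
      rw [show k₀ i + F + 1 + m = k₀ i + m + F + 1 by ring] at hk he
      rw [hstart i _ (by omega)] at he
      exact ⟨k₀ i + m, (hS i _ (by omega)).1 hk, by linarith⟩
    · rintro ⟨k, hk, he⟩
      have h1 := hI i k _ x hk hx he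
      have h2 := E.le_start_iff_of_phase hc ((hτ i).trans ht) h1
      exact ⟨k + F + 1, (hS i k h2).2 hk, by rw [hstart i k h2]; linarith⟩
  have hPF : E.PeriodicFrom τ T := by
    intro t ht i s
    cases s with
    | initialization =>
      have h1 := (hmono i).monotone (Nat.zero_le (k₀ i))
      have h2 := hτ i
      refine iff_of_false (fun h => ?_) (fun h => ?_) <;> · simp only [InState] at h; linarith
    | successfulRetry x =>
      have := fun hx => key E.success hper (fun x => x < 1) (fun i k t x hs hx he =>
        hphase i k _ Iff.rfl t x he (Or.inl hx)) t ht i x hx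
      constructor <;> rintro ⟨k, h1, h2, h3, h4⟩
      · obtain ⟨k', h1, h2⟩ := (this h4).1 ⟨k, h1, h2⟩
        exact ⟨k', h1, h2, h3, h4⟩
      · obtain ⟨k', h1, h2⟩ := (this h4).2 ⟨k, h1, h2⟩
        exact ⟨k', h1, h2, h3, h4⟩
    | unsuccessfulRetry x =>
      have := fun hx => key (fun i k => ¬ E.success i k) (fun i k hk => not_congr (hper i k hk))
        (fun x => x < 1) (fun i k t x hs hx he => hphase i k _ Iff.rfl t x he (Or.inl hx))
        t ht i x hx
      constructor <;> rintro ⟨k, h1, h2, h3, h4⟩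
      · obtain ⟨k', h1, h2⟩ := (this h4).1 ⟨k, h1, h2⟩
        exact ⟨k', h1, h2, h3, h4⟩
      · obtain ⟨k', h1, h2⟩ := (this h4).2 ⟨k, h1, h2⟩
        exact ⟨k', h1, h2, h3, h4⟩
    | parallelSection x =>
      have := fun hx => key E.success hper (fun x => x < 1 + (q + r)) (fun i k t x hs hx he =>
        hphase i k _ Iff.rfl t x he (Or.inr ⟨hs, hx⟩)) t ht i (1 + x) hx
      constructor <;> rintro ⟨k, h1, h2, h3, h4⟩
      · obtain ⟨k', h1, h2⟩ := (this (by linarith)).1 ⟨k, h1, by linarith⟩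
        exact ⟨k', h1, by linarith, h3, h4⟩
      · obtain ⟨k', h1, h2⟩ := (this (by linarith)).2 ⟨k, h1, by linarith⟩
        exact ⟨k', h1, by linarith, h3, h4⟩
  have huniq : ∀ i s, τ ≤ s → ∃! k, E.success i k ∧ s ≤ E.start i k ∧ E.start i k < s + T := by
    intro i s hs
    refine existsUnique_of_exists_of_unique ?_ ?_
    · have h1 : 0 ≤ (s - E.start i (k₀ i)) / T := div_nonneg (by linarith [hτ i]) hT.le
      refine ⟨k₀ i + ⌈(s - E.start i (k₀ i)) / T⌉₊ * (F + 1), hsucc i _, ?_⟩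
      have h2 := Nat.le_ceil ((s - E.start i (k₀ i)) / T)
      have h3 := Nat.ceil_lt_add_one h1
      rw [hstart_mul]
      rw [div_le_iff₀ hT] at h2
      rw [← sub_lt_iff_lt_add, lt_div_iff₀ hT] at h3
      constructor <;> linarith
    · have hlt : ∀ k l, k < l → E.success i k → E.success i l → s ≤ E.start i k →
          s + T ≤ E.start i l := by
        intro k l hkl hk hl hsk
        have h1 : k₀ i ≤ k := (hmono i).le_iff_le.1 (((hτ i).trans hs).trans hsk)
        have h2 : k + F + 1 ≤ l := by
          by_contra hcon
          have := (hreg i k h1 hk).1 (l - k) (by omega) (by omega)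
          rw [Nat.add_sub_cancel' hkl.le] at this
          exact this hl
        have h3 := (hmono i).monotone h2
        rw [hstart i k h1] at h3
        linarith
      rintro k l ⟨k1, k2, k3⟩ ⟨l1, l2, l3⟩
      rcases lt_trichotomy k l with h | h | h
      · linarith [hlt k l h k1 l1 k2]
      · exact h
      · linarith [hlt l k h l1 k1 l2]
  refine ⟨τ, ⟨⟨hT, hPF⟩, ?_⟩, huniq⟩
  rintro T' ⟨hT', hPT'⟩
  by_contra hcon
  -- At time `τ` the thread `i₁` starts a success. A period shorter than `T` would give it a second
  -- one within `[τ, τ + T)`.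
  obtain ⟨k, hk, he, -⟩ := (hPT' τ le_rfl i₁ (.successfulRetry 0)).2
    ⟨k₀ i₁, h0 i₁, by simp [τ], le_rfl, one_pos⟩
  have := (huniq i₁ τ le_rfl).unique (y₁ := k) (y₂ := k₀ i₁) ⟨hk, by linarith, by linarith⟩
    ⟨h0 i₁, le_rfl, by simp only [τ]; linarith⟩
  subst this
  simp only [τ] at he
  linarith

end Execution
end LockFree

theorem mainTheorem2 (q : ℕ) (r : ℝ) (hr0 : 0 ≤ r) (hr1 : r < 1) (hr : r ≠ 0) (f n : ℕ)
    (E : LockFree.Execution q r n) (τ : ℝ) (hE : E.IsCyclicFrom f τ)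
    (ν : Fin (n + 1)) (a : ℝ) (ha : τ ≤ a)
    (E' : LockFree.Execution q r (n + 1)) (hadd : E.AddsThread E' ν a) :
    ∃ τ' : ℝ, E'.IsCyclicFrom f τ' ∨ E'.IsCyclicFrom (f + 1) τ' := by
  have hr0' : 0 < r := lt_of_le_of_ne hr0 hr.symm
  have hq : (0 : ℝ) ≤ q := by positivity
  have hc : 0 < q + r := by linarith
  have hcK : (0 : ℝ*) < q + r := by
    have := Hyperreal.coe_pos.2 hc
    rwa [Hyperreal.coe_add, LockFree.coe_natCast_hyperreal] at this
  obtain ⟨kν, R, I⟩ := LockFree.Execution.exists_insertion hE hr0' hr1 ha hadd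
  obtain ⟨F, hF, i₀, k₀, hex, hreg⟩ := I.eventually_const (Hyperreal.coe_pos.2 hr0')
    (by exact_mod_cast hr1) (by
      obtain ⟨t, ht⟩ := exists_nat_gt (1 / r)
      rw [div_lt_iff₀ hr0'] at ht
      refine ⟨t, ?_⟩
      rw [← LockFree.coe_natCast_hyperreal, ← Hyperreal.coe_mul, ← Hyperreal.coe_one,
        Hyperreal.coe_le_coe]
      exact ht.le)
  choose k hk1 hk2 using hex
  obtain ⟨τ', hτ'⟩ := E'.isCyclicFrom_of_regular n.succ_pos hc F k hk1 fun i l hl hs =>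
    hreg i l hs ((hk2 i).trans
      (((E'.toRun (RelEmbedding.refl _)).start_strictMono hcK i).monotone hl))
  rcases hF with rfl | rfl
  · exact ⟨τ', Or.inl hτ'⟩
  · exact ⟨τ', Or.inr hτ'⟩
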